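/- A linearly ordered $\mathbb{Z}_2$-graded set is a linearly ordered set $\mathcal A$ with a degree $|a|\in\mathbb{Z}_2$ for each $a\in\mathcal A$. Let $\mathbb{N}=\{1<2<\cdots\}$ and $\mathbb{N}^\vee=\{\cdots<2^\vee<1^\vee\}$, where all elements have degree $0$. For linearly ordered $\mathbb{Z}_2$-graded sets $\mathcal A,\mathcal B$, let $\mathcal M_{\mathcal A,\mathcal B}$ be the set of matrices $M=(m_{ab})_{a\in\mathcal A,\,b\in\mathcal B}$ with entries in $\mathbb{Z}_{\ge 0}$, only finitely many of them nonzero, such that $m_{ab}\le 1$ whenever $|a|\ne|b|$. Put $|M|=\sum_{a,b}m_{ab}$, and, in the free abelian groups with bases $\{\epsilon_a\}_{a\in\mathcal A}$ and $\{\epsilon_b\}_{b\in\mathcal B}$, put $\mathrm{wt}_{\mathcal A}(M)=\sum_{a,b}m_{ab}\,\epsilon_a$ and $\mathrm{wt}_{\mathcal B}(M)=\sum_{a,b}m_{ab}\,\epsilon_b$. Order $\mathcal A\times\mathcal B$ linearly by: $(a,b)<(c,d)$ if and only if $a<c$, or $a=c$, $|a|=0$ and $b>d$, or $a=c$, $|a|=1$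 and $b<d$. The biword of $M$ is the weakly increasing sequence $(i_1,j_1)\le\cdots\le(i_r,j_r)$ in which each $(a,b)$ occurs exactly $m_{ab}$ times. Let $t$ be an indeterminate and let $\mathscr U(t)$ be the associative unital $\mathbb{Q}[t,t^{-1}]$-algebra generated by $u_i,u_{i^\vee}$ ($i\in\mathbb{N}$) subject to the relations $$u_iu_ju_k=u_iu_ku_j,\quad u_{k^\vee}u_{j^\vee}u_{i^\vee}=u_{j^\vee}u_{k^\vee}u_{i^\vee}\qquad(j\le i<k),$$ $$u_iu_ju_k=u_ju_iu_k,\quad u_{k^\vee}u_{j^\vee}u_{i^\vee}=u_{k^\vee}u_{i^\vee}u_{j^\vee}\qquad(j<k\le i),$$ $$u_{i+1}u_{(i+1)^\vee}=u_{i^\vee}u_i\quad(i\ge 1),\qquad u_1u_{1^\vee}=t,\qquad u_iu_{j^\vee}=u_{j^\vee}u_i\quad(i\ne j).$$ For $M$ in $\mathcal M_{\mathcal A,\mathbb{N}}$ or $\mathcal M_{\mathcal A,\mathbb{N}^\vee}$ with biword $(i_1,j_1)\le\cdots\le(i_r,j_r)$, put $u_M=u_{j_1}\cdots u_{j_r}\in\mathscr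 U(t)$. **Theorem.** For all linearly ordered $\mathbb{Z}_2$-graded sets $\mathcal A$ and $\mathcal B$ there exists a bijection $$\mathcal M_{\mathcal A,\mathbb{N}}\times\mathcal M_{\mathcal B,\mathbb{N}^\vee}\longrightarrow\mathcal M_{\mathcal B,\mathbb{N}^\vee}\times\mathcal M_{\mathcal A,\mathbb{N}}\times\mathcal M_{\mathcal A,\mathcal B},\qquad (X,Y)\longmapsto(Y',X',Z),$$ such that for all $(X,Y)$: 1. $\mathrm{wt}_{\mathcal A}(X)=\mathrm{wt}_{\mathcal A}(X')+\mathrm{wt}_{\mathcal A}(Z)$ and $\mathrm{wt}_{\mathcal B}(Y)=\mathrm{wt}_{\mathcal B}(Y')+\mathrm{wt}_{\mathcal B}(Z)$; 2. $u_Xu_Y=t^{|Z|}\,u_{Y'}u_{X'}$ in $\mathscr U(t)$. -/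

import Mathlib

open scoped LaurentPolynomial

noncomputable section

namespace PlacticKnuth

/-- A `ℤ/2`-grading of a set: each element has a degree `|a|` in `ℤ/2`. -/
class Z2Graded (A : Type*) where
  deg : A → ZMod 2

open Z2Graded

/-- The elements of `ℕ = {1 < 2 < ⋯}` all have degree `0`. -/
instance : Z2Graded ℕ+ := ⟨fun _ => 0⟩

/-- The dual set `A^∨`: same degrees, reversed order. The element `a^∨` is `OrderDual.toDual a`. -/
instance {A : Type*} [Z2Graded A] : Z2Graded Aᵒᵈ := ⟨fun a => deg (OrderDual.ofDual a)⟩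

/-- `A × B` matrices over `ℕ` with finitely many nonzero entries, whose `(a, b)` entry is at
most `1` when `|a| ≠ |b|`. -/
@[ext]
structure Mat (A B : Type*) [Z2Graded A] [Z2Graded B] where
  entries : A × B →₀ ℕ
  le_one : ∀ a b, deg a ≠ deg b → entries (a, b) ≤ 1

section Biwords

variable {A B : Type*} [LinearOrder A] [Z2Graded A] [LinearOrder B]

/-- The strict order on biletters. -/
def BLT (p q : A × B) : Prop :=
  p.1 < q.1 ∨ (p.1 = q.1 ∧ deg p.1 = 0 ∧ q.2 < p.2) ∨ (p.1 = q.1 ∧ deg p.1 = 1 ∧ p.2 < q.2)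

/-- The weak order on biletters. -/
def BLE (p q : A × B) : Prop := p = q ∨ BLT p q

theorem BLT.trans {p q r : A × B} (h : BLT p q) (k : BLT q r) : BLT p r := by
  obtain ⟨a, b⟩ := p
  obtain ⟨c, d⟩ := q
  obtain ⟨e, f⟩ := r
  simp only [BLT] at *
  rcases h with h | ⟨rfl, h, h'⟩ | ⟨rfl, h, h'⟩
  · rcases k with k | ⟨rfl, k, k'⟩ | ⟨rfl, k, k'⟩
    · exact Or.inl (h.trans k)
    · exact Or.inl h
    · exact Or.inl h
  · rcases k with k | ⟨rfl, k, k'⟩ | ⟨rfl, k, k'⟩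
    · exact Or.inl k
    · exact Or.inr (Or.inl ⟨rfl, h, k'.trans h'⟩)
    · simp [h] at k
  · rcases k with k | ⟨rfl, k, k'⟩ | ⟨rfl, k, k'⟩
    · exact Or.inl k
    · simp [h] at k
    · exact Or.inr (Or.inr ⟨rfl, h, h'.trans k'⟩)

theorem BLT.irrefl (p : A × B) : ¬ BLT p p := by
  simp [BLT]

instance : IsTrans (A × B) BLE where
  trans p q r h k := by
    rcases h with rfl | h
    · exact k
    · rcases k with rfl | k
      · exact Or.inr h
      · exact Or.inr (h.trans k)

instance : Std.Antisymm (BLE (A := A) (B := B)) where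
  antisymm p q h k := by
    rcases h with rfl | h
    · rfl
    · rcases k with rfl | k
      · rfl
      · exact absurd (h.trans k) (BLT.irrefl p)

instance : Std.Total (BLE (A := A) (B := B)) where
  total p q := by
    obtain ⟨a, b⟩ := p
    obtain ⟨c, d⟩ := q
    have hz : ∀ x : ZMod 2, x = 0 ∨ x = 1 := by decide
    rcases lt_trichotomy a c with h | rfl | h
    · exact Or.inl (Or.inr (Or.inl h))
    · rcases lt_trichotomy b d with k | rfl | k
      · rcases hz (deg a) with e | e
        · exact Or.inr (Or.inr (Or.inr (Or.inl ⟨rfl, e, k⟩)))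
        · exact Or.inl (Or.inr (Or.inr (Or.inr ⟨rfl, e, k⟩)))
      · exact Or.inl (Or.inl rfl)
      · rcases hz (deg a) with e | e
        · exact Or.inl (Or.inr (Or.inr (Or.inl ⟨rfl, e, k⟩)))
        · exact Or.inr (Or.inr (Or.inr (Or.inr ⟨rfl, e, k⟩)))
    · exact Or.inr (Or.inr (Or.inl h))

variable [Z2Graded B]

/-- A biword, written as the list of its biletters `(i_s, j_s)`: it is weakly increasing, and
strictly increasing at each `s` with `|i_s| ≠ |j_s|`. -/
def IsBiword (w : List (A × B)) : Prop :=
  w.IsChain fun p q => BLE p q ∧ (deg p.1 ≠ deg p.2 → BLT p q)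

open scoped Classical in
/-- The biword of a matrix: `(a, b)` occurs as many times as the `(a, b)` entry says, in
increasing order. It is the only biword with these multiplicities, see `Mat.isBiword_biword`,
`Mat.coe_biword` and `Mat.eq_biword`. -/
def Mat.biword (M : Mat A B) : List (A × B) :=
  (Finsupp.toMultiset M.entries).sort BLE

theorem Mat.coe_biword (M : Mat A B) :
    (M.biword : Multiset (A × B)) = Finsupp.toMultiset M.entries := by
  classical
  exact Multiset.sort_eq _ _

theorem Mat.isBiword_biword (M : Mat A B) : IsBiword M.biword := by
  classical
  refine List.isChain_iff_forall_rel_of_append_cons_cons.2 ?_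
  intro p q l₁ l₂ h
  have hs : M.biword.Pairwise BLE := Multiset.pairwise_sort _ _
  have hpq : BLE p q := by
    rw [h] at hs
    exact (List.pairwise_cons.1 (List.pairwise_append.1 hs).2.1).1 q (by simp)
  refine ⟨hpq, fun hd => hpq.resolve_left ?_⟩
  rintro rfl
  have h1 : M.entries p ≤ 1 := M.le_one p.1 p.2 hd
  rw [← Finsupp.count_toMultiset, ← M.coe_biword, h, ← Multiset.coe_add, Multiset.count_add,
    ← Multiset.cons_coe, ← Multiset.cons_coe, Multiset.count_cons_self,
    Multiset.count_cons_self] at h1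
  omega

theorem Mat.eq_biword (M : Mat A B) (w : List (A × B)) (hw : IsBiword w)
    (hc : (w : Multiset (A × B)) = Finsupp.toMultiset M.entries) : w = M.biword := by
  classical
  have h : w.IsChain BLE := hw.imp fun _ _ h => h.1
  exact List.Perm.eq_of_pairwise' (r := BLE) h.pairwise (Multiset.pairwise_sort _ _)
    (Multiset.coe_eq_coe.1 (hc.trans M.coe_biword.symm))

/-- The weight `∑ ε_{w_i}` of a word, in the free abelian group on the letters. -/
def wordWt {C : Type*} (w : List C) : C →₀ ℤ :=
  (w.map fun c => Finsupp.single c 1).sum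

/-- The weight of a matrix with respect to its row index set. -/
def Mat.rowWt (M : Mat A B) : A →₀ ℤ := wordWt (M.biword.map Prod.fst)

/-- The weight of a matrix with respect to its column index set. -/
def Mat.colWt (M : Mat A B) : B →₀ ℤ := wordWt (M.biword.map Prod.snd)

/-- The sum `|M|` of all entries. -/
def Mat.size (M : Mat A B) : ℕ := ∑ p ∈ M.entries.support, M.entries p

end Biwords

/-- The alphabet `ℕ ⊔ ℕ^∨`. -/
abbrev Letter : Type := ℕ+ ⊕ ℕ+ᵒᵈ

/-- The letter `i`. -/
def pos (i : ℕ+) : Letter := Sum.inl i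

/-- The letter `i^∨`. -/
def dual (i : ℕ+) : Letter := Sum.inr (OrderDual.toDual i)

/-- The free associative unital `ℚ[t, t⁻¹]`-algebra on the letters. -/
abbrev FreeAlg : Type := FreeAlgebra ℚ[T;T⁻¹] Letter

/-- The generator `u_i` of the free algebra. -/
def fpos (i : ℕ+) : FreeAlg := FreeAlgebra.ι _ (pos i)

/-- The generator `u_{i^∨}` of the free algebra. -/
def fdual (i : ℕ+) : FreeAlg := FreeAlgebra.ι _ (dual i)

/-- The indeterminate `t`. -/
def t : ℚ[T;T⁻¹] := LaurentPolynomial.T 1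

/-- The defining relations of the plactic algebra. -/
inductive PlacticRel : FreeAlg → FreeAlg → Prop
  | knuth₁ (i j k : ℕ+) : j ≤ i → i < k →
      PlacticRel (fpos i * fpos j * fpos k) (fpos i * fpos k * fpos j)
  | knuth₁_dual (i j k : ℕ+) : j ≤ i → i < k →
      PlacticRel (fdual k * fdual j * fdual i) (fdual j * fdual k * fdual i)
  | knuth₂ (i j k : ℕ+) : j < k → k ≤ i →
      PlacticRel (fpos i * fpos j * fpos k) (fpos j * fpos i * fpos k)
  | knuth₂_dual (i j k : ℕ+) : j < k → k ≤ i →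
      PlacticRel (fdual k * fdual j * fdual i) (fdual k * fdual i * fdual j)
  | cross (i : ℕ+) : PlacticRel (fpos (i + 1) * fdual (i + 1)) (fdual i * fpos i)
  | cancel : PlacticRel (fpos 1 * fdual 1) (algebraMap ℚ[T;T⁻¹] FreeAlg t)
  | comm (i j : ℕ+) : i ≠ j → PlacticRel (fpos i * fdual j) (fdual j * fpos i)

/-- The plactic algebra `U(t)`. -/
abbrev PlacticAlgebra : Type := RingQuot PlacticRel

/-- The generator of `U(t)` given by a letter. -/
def u (c : Letter) : PlacticAlgebra :=
  RingQuot.mkAlgHom ℚ[T;T⁻¹] PlacticRel (FreeAlgebra.ι _ c)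

/-- The monomial `u_w = u_{w_1} ⋯ u_{w_r}` of a word. -/
def uWord (w : List Letter) : PlacticAlgebra := (w.map u).prod

/-- `u_X` for a matrix `X` with columns indexed by `ℕ`: the monomial of the second word of the
biword of `X`. -/
def uMat {A : Type*} [LinearOrder A] [Z2Graded A] (X : Mat A ℕ+) : PlacticAlgebra :=
  uWord (X.biword.map fun p => Sum.inl p.2)

/-- `u_Y` for a matrix `Y` with columns indexed by `ℕ^∨`. -/
def uMatDual {B : Type*} [LinearOrder B] [Z2Graded B] (Y : Mat B ℕ+ᵒᵈ) : PlacticAlgebra :=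
  uWord (Y.biword.map fun p => Sum.inr p.2)

end PlacticKnuth

end

namespace PlacticKnuth

open Z2Graded

/-! The mixed relations let a pair drop one level, `u_{i+1} u_{(i+1)^∨} = u_{i^∨} u_i`, and leave as
`t` at the bottom. When one row of letters passes one row of dual letters, it remains to choose how
many pairs each level sends to the next lower one. `carry` makes this choice: multiplicities `x`,
`y` and `c` incoming pairs yield `c'` outgoing pairs and new multiplicities `x + c - c'`, `y + c -
c'`. The rule is an involution (`carry_carry`). Run from the top with nothing incoming, it produces
two new rows and a number of pairs leaving at the bottom; run from the bottom upwards, it undoes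
itself. This is the bijection for two rows (`Config.bijective_rows`, `Config.bijective_out`).

That the rule holds in the algebra is `Config.prod_eq`: induction on the level, with the pairs in
transit kept where the letters of the top level stand, which depends on the two degrees.

The biword of a matrix is the concatenation of its row words (`Mat.biword_eq`), so `Exchange.piLeft`
and `Exchange.piRight` move rows past rows one pair at a time, and the numbers of escaping pairs are
the entries of `Z`. For arbitrary index sets, a weight confines matrices to finitely many rows, and
the bijections for the various weights are glued. -/

theorem zmod2_eq_zero_or_one : ∀ ε : ZMod 2, ε = 0 ∨ ε = 1 := by decide

/-! ### The local exchange rule -/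

/-- The number of pairs which the local exchange rule sends from one level to the next lower one,
when `x` letters, `y` dual letters and `c` pairs from above meet. -/
def carry (ε δ : ZMod 2) (x y c : ℕ) : ℕ :=
  if ε = 0 then (if δ = 0 then min x y else min (x + c) y)
  else (if δ = 0 then min x (y + c) else c + x + y - 1)

@[simp] theorem carry_zero_zero (x y c : ℕ) : carry 0 0 x y c = min x y := by simp [carry]

@[simp] theorem carry_zero_one (x y c : ℕ) : carry 0 1 x y c = min (x + c) y := by simp [carry]

@[simp] theorem carry_one_zero (x y c : ℕ) : carry 1 0 x y c = min x (y + c) := by simp [carry]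

@[simp] theorem carry_one_one (x y c : ℕ) : carry 1 1 x y c = c + x + y - 1 := by simp [carry]

/-- The multiplicities allowed at a single level. -/
structure Admissible (ε δ : ZMod 2) (x y c : ℕ) : Prop where
  left : ε ≠ 0 → x ≤ 1
  right : δ ≠ 0 → y ≤ 1
  pair : ε ≠ δ → c ≤ 1

section Local

variable {ε δ : ZMod 2} {x y c : ℕ}

/-- With `carry_le_right`, ensures that the subtractions in the exchange rule are never truncated.
-/
theorem carry_le_left (h : Admissible ε δ x y c) : carry ε δ x y c ≤ x + c := by
  obtain ⟨h₁, h₂, h₃⟩ := h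
  rcases zmod2_eq_zero_or_one ε with rfl | rfl <;> rcases zmod2_eq_zero_or_one δ with rfl | rfl <;>
    simp at * <;> omega

theorem carry_le_right (h : Admissible ε δ x y c) : carry ε δ x y c ≤ y + c := by
  obtain ⟨h₁, h₂, h₃⟩ := h
  rcases zmod2_eq_zero_or_one ε with rfl | rfl <;> rcases zmod2_eq_zero_or_one δ with rfl | rfl <;>
    simp at * <;> omega

/-- The same rule thus serves in both directions. For two odd rows it replaces `x`, `y` by `1 - y`,
`1 - x`, except at `x = y = c = 0`, where the truncated `- 1` keeps everything zero. -/
theorem carry_carry (h : Admissible ε δ x y c) :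
    carry ε δ (x + c - carry ε δ x y c) (y + c - carry ε δ x y c) (carry ε δ x y c) = c := by
  obtain ⟨h₁, h₂, h₃⟩ := h
  rcases zmod2_eq_zero_or_one ε with rfl | rfl <;> rcases zmod2_eq_zero_or_one δ with rfl | rfl <;>
    simp at * <;> omega

theorem Admissible.exchange (h : Admissible ε δ x y c) :
    Admissible ε δ (x + c - carry ε δ x y c) (y + c - carry ε δ x y c) (carry ε δ x y c) := by
  obtain ⟨h₁, h₂, h₃⟩ := h
  constructor <;>
  rcases zmod2_eq_zero_or_one ε with rfl | rfl <;> rcases zmod2_eq_zero_or_one δ with rfl | rfl <;>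
    simp at * <;> omega

/-- For mixed degrees the carry is a minimum with the multiplicity in the odd row, whatever `c` is.
-/
theorem carry_pair_le_one (h₁ : ε ≠ 0 → x ≤ 1) (h₂ : δ ≠ 0 → y ≤ 1) (h : ε ≠ δ) :
    carry ε δ x y c ≤ 1 := by
  rcases zmod2_eq_zero_or_one ε with rfl | rfl <;> rcases zmod2_eq_zero_or_one δ with rfl | rfl <;>
    simp at * <;> omega

/-- Each empty level absorbs a pair, which makes the upward recursion die out. -/
theorem carry_of_zero_le (ε δ : ZMod 2) (c : ℕ) : carry ε δ 0 0 c ≤ c - 1 := by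
  rcases zmod2_eq_zero_or_one ε with rfl | rfl <;> rcases zmod2_eq_zero_or_one δ with rfl | rfl <;>
    simp

end Local

/-! ### Rows -/

/-- A finitely supported sequence of multiplicities, at most `1` in degree `ε ≠ 0`. -/
@[ext]
structure Row (ε : ZMod 2) where
  val : ℕ → ℕ
  finite : ∃ n, ∀ k, n ≤ k → val k = 0
  le_one : ε ≠ 0 → ∀ k, val k ≤ 1

/-- A bound for the support of a row. -/
noncomputable def Row.bound {ε : ZMod 2} (x : Row ε) : ℕ := x.finite.choose

theorem Row.val_eq_zero {ε : ZMod 2} (x : Row ε) {k : ℕ} (h : x.bound ≤ k) : x.val k = 0 :=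
  x.finite.choose_spec k h

/-- A function of the truncation level that does not see zero entries is constant above the
bound of a row. -/
theorem Row.stable {ε : ZMod 2} {T : Type*} (x : Row ε) (F : ℕ → T)
    (hF : ∀ n, x.val n = 0 → F (n + 1) = F n) {n : ℕ} (hn : x.bound ≤ n) : F n = F x.bound := by
  induction n, hn using Nat.le_induction with
  | base => rfl
  | succ n hn ih => rw [hF n (x.val_eq_zero hn), ih]

/-- The total multiplicity of a row. -/
noncomputable def Row.total {ε : ZMod 2} (x : Row ε) : ℕ := ∑ k ∈ Finset.range x.bound, x.val k

theorem Row.total_eq {ε : ZMod 2} (x : Row ε) {n : ℕ} (hn : x.bound ≤ n) :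
    ∑ k ∈ Finset.range n, x.val k = x.total :=
  x.stable (fun n => ∑ k ∈ Finset.range n, x.val k)
    (fun n h => by rw [Finset.sum_range_succ, h, add_zero]) hn

open scoped Classical in
/-- The weakly increasing (if `asc`) or weakly decreasing word with multiplicities `x`, truncated
at level `n`. -/
noncomputable def levelWord (asc : Prop) (x : ℕ → ℕ) : ℕ → List ℕ
  | 0 => []
  | n + 1 => if asc then levelWord asc x n ++ List.replicate (x n) n
      else List.replicate (x n) n ++ levelWord asc x n

theorem levelWord_succ_of {asc : Prop} (h : asc) (x : ℕ → ℕ) (n : ℕ) :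
    levelWord asc x (n + 1) = levelWord asc x n ++ List.replicate (x n) n := by
  simp [levelWord, h]

theorem levelWord_succ_of_not {asc : Prop} (h : ¬ asc) (x : ℕ → ℕ) (n : ℕ) :
    levelWord asc x (n + 1) = List.replicate (x n) n ++ levelWord asc x n := by
  simp [levelWord, h]

/-- The word of a row. -/
noncomputable def Row.word {ε : ZMod 2} (asc : Prop) (x : Row ε) : List ℕ :=
  levelWord asc x.val x.bound

theorem Row.word_eq {ε : ZMod 2} (asc : Prop) (x : Row ε) {n : ℕ} (hn : x.bound ≤ n) :
    levelWord asc x.val n = x.word asc :=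
  x.stable (levelWord asc x.val) (fun n h => by simp [levelWord, h]) hn

theorem lt_of_mem_levelWord {asc : Prop} {x : ℕ → ℕ} {n k : ℕ} (h : k ∈ levelWord asc x n) :
    k < n := by
  induction n with
  | zero => simp [levelWord] at h
  | succ n ih =>
    by_cases ha : asc
    · rw [levelWord_succ_of ha, List.mem_append, List.mem_replicate] at h
      rcases h with h | h
      · exact (ih h).trans (Nat.lt_succ_self n)
      · omega
    · rw [levelWord_succ_of_not ha, List.mem_append, List.mem_replicate] at h
      rcases h with h | h
      · omega
      · exact (ih h).trans (Nat.lt_succ_self n)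

theorem pairwise_levelWord_of {asc : Prop} (ha : asc) (x : ℕ → ℕ) (n : ℕ) :
    (levelWord asc x n).Pairwise (· ≤ ·) := by
  induction n with
  | zero => simp [levelWord]
  | succ n ih =>
    rw [levelWord_succ_of ha, List.pairwise_append]
    refine ⟨ih, by simp [List.pairwise_replicate], fun k hk l hl => ?_⟩
    rw [List.eq_of_mem_replicate hl]
    exact (lt_of_mem_levelWord hk).le

theorem pairwise_levelWord_of_not {asc : Prop} (ha : ¬ asc) (x : ℕ → ℕ) (n : ℕ) :
    (levelWord asc x n).Pairwise (· ≥ ·) := by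
  induction n with
  | zero => simp [levelWord]
  | succ n ih =>
    rw [levelWord_succ_of_not ha, List.pairwise_append]
    refine ⟨by simp [List.pairwise_replicate], ih, fun k hk l hl => ?_⟩
    rw [List.eq_of_mem_replicate hk]
    exact (lt_of_mem_levelWord hl).le

theorem coe_levelWord (asc : Prop) (x : ℕ → ℕ) (n : ℕ) :
    (levelWord asc x n : Multiset ℕ) = ∑ k ∈ Finset.range n, x k • ({k} : Multiset ℕ) := by
  induction n with
  | zero => simp [levelWord]
  | succ n ih =>
    rw [Finset.sum_range_succ, Multiset.nsmul_singleton, ← ih, ← Multiset.coe_replicate,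
      Multiset.coe_add]
    by_cases ha : asc
    · rw [levelWord_succ_of ha]
    · rw [levelWord_succ_of_not ha]
      exact Multiset.coe_eq_coe.2 List.perm_append_comm

/-! ### Carry sequences -/

/-- `c` records the pairs carried between the levels when the row `x` passes the row `y`. -/
structure IsCarry (ε δ : ZMod 2) (x y c : ℕ → ℕ) : Prop where
  finite : ∃ n, ∀ k, n ≤ k → c k = 0
  step : ∀ k, c k = carry ε δ (x k) (y k) (c (k + 1))

/-- Both sequences vanish high up, and `step` propagates equality downwards. Finiteness is
essential: for two empty odd rows, `c k = k` also satisfies `step`. -/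
theorem IsCarry.unique {ε δ : ZMod 2} {x y c d : ℕ → ℕ} (hc : IsCarry ε δ x y c)
    (hd : IsCarry ε δ x y d) : c = d := by
  obtain ⟨n, hn⟩ := hc.finite
  obtain ⟨m, hm⟩ := hd.finite
  have key : ∀ j k, n + m ≤ k + j → c k = d k := by
    intro j
    induction j with
    | zero => intro k hk; rw [hn k (by omega), hm k (by omega)]
    | succ j ih => intro k hk; rw [hc.step, hd.step, ih (k + 1) (by omega)]
  funext k
  exact key (n + m) k (by omega)

theorem exists_isCarry_of_bound (ε δ : ZMod 2) (n : ℕ) : ∀ x y : ℕ → ℕ,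
    (∀ k, n ≤ k → x k = 0) → (∀ k, n ≤ k → y k = 0) → ∃ c, IsCarry ε δ x y c := by
  induction n with
  | zero =>
    intro x y hx hy
    refine ⟨0, ⟨0, by simp⟩, fun k => ?_⟩
    have := carry_of_zero_le ε δ 0
    simp only [hx k (Nat.zero_le k), hy k (Nat.zero_le k), Pi.zero_apply]
    omega
  | succ n ih =>
    intro x y hx hy
    obtain ⟨c, ⟨m, hm⟩, hc⟩ := ih (fun k => x (k + 1)) (fun k => y (k + 1))
      (fun k hk => hx _ (by omega)) (fun k hk => hy _ (by omega))
    refine ⟨fun k => Nat.casesOn k (carry ε δ (x 0) (y 0) (c 0)) c, ⟨m + 1, ?_⟩, ?_⟩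
    · rintro (_ | k) hk
      · omega
      · exact hm k (by omega)
    · rintro (_ | k)
      · rfl
      · exact hc k

theorem exists_isCarry {ε δ : ZMod 2} (x : Row ε) (y : Row δ) :
    ∃ c, IsCarry ε δ x.val y.val c := by
  refine exists_isCarry_of_bound ε δ (max x.bound y.bound) x.val y.val ?_ ?_ <;> intro k hk
  · exact x.val_eq_zero (le_of_max_le_left hk)
  · exact y.val_eq_zero (le_of_max_le_right hk)

theorem IsCarry.pair_le_one {ε δ : ZMod 2} {x : Row ε} {y : Row δ} {c : ℕ → ℕ}
    (hc : IsCarry ε δ x.val y.val c) (h : ε ≠ δ) (k : ℕ) : c k ≤ 1 := by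
  rw [hc.step]
  exact carry_pair_le_one (fun h => x.le_one h k) (fun h => y.le_one h k) h

theorem IsCarry.admissible {ε δ : ZMod 2} {x : Row ε} {y : Row δ} {c : ℕ → ℕ}
    (hc : IsCarry ε δ x.val y.val c) (k : ℕ) : Admissible ε δ (x.val k) (y.val k) (c (k + 1)) :=
  ⟨fun h => x.le_one h k, fun h => y.le_one h k, fun h => hc.pair_le_one h _⟩

/-- The carry sequence of the inverse exchange, which runs from the bottom level upwards. -/
def upCarry (ε δ : ZMod 2) (x y : ℕ → ℕ) (z : ℕ) : ℕ → ℕ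
  | 0 => z
  | k + 1 => carry ε δ (x k) (y k) (upCarry ε δ x y z k)

theorem upCarry_finite {ε δ : ZMod 2} (x : Row ε) (y : Row δ) (z : ℕ) :
    ∃ n, ∀ k, n ≤ k → upCarry ε δ x.val y.val z k = 0 := by
  set c := upCarry ε δ x.val y.val z with hc
  set n := max x.bound y.bound with hn
  -- Above both supports every level loses a pair, so `c n` further levels suffice.
  have key : ∀ j, c (n + j) ≤ c n - j := by
    intro j
    induction j with
    | zero => simp
    | succ j ih =>
      have h : c (n + (j + 1)) = carry ε δ (x.val (n + j)) (y.val (n + j)) (c (n + j)) := rfl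
      rw [x.val_eq_zero (by omega), y.val_eq_zero (by omega)] at h
      have := carry_of_zero_le ε δ (c (n + j))
      omega
  refine ⟨n + c n, fun k hk => ?_⟩
  have := key (k - n)
  rw [Nat.add_sub_cancel' (by omega)] at this
  omega

/-- The multiplicities of pairs of a letter of degree `ε` and a letter of degree `δ`. -/
abbrev Mult (ε δ : ZMod 2) : Type := {z : ℕ // ε ≠ δ → z ≤ 1}

theorem upCarry_pair_le_one {ε δ : ZMod 2} (x : Row ε) (y : Row δ) (z : Mult ε δ) (h : ε ≠ δ)
    (k : ℕ) : upCarry ε δ x.val y.val z k ≤ 1 := by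
  cases k with
  | zero => exact z.2 h
  | succ k => exact carry_pair_le_one (fun h => x.le_one h k) (fun h => y.le_one h k) h

/-- Two rows together with their carry sequence. -/
@[ext]
structure Config (ε δ : ZMod 2) where
  x : Row ε
  y : Row δ
  c : ℕ → ℕ
  isCarry : IsCarry ε δ x.val y.val c

namespace Config

variable {ε δ : ZMod 2}

theorem bijective_rows :
    Function.Bijective fun w : Config ε δ => (w.x, w.y) := by
  constructor
  · rintro ⟨x, y, c, h⟩ ⟨x', y', c', h'⟩ e
    obtain ⟨rfl, rfl⟩ := Prod.mk.inj e
    obtain rfl := h.unique h'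
    rfl
  · rintro ⟨x, y⟩
    obtain ⟨c, hc⟩ := exists_isCarry x y
    exact ⟨⟨x, y, c, hc⟩, rfl⟩

/-- The first row after the exchange. -/
def outX (w : Config ε δ) : Row ε where
  val k := w.x.val k + w.c (k + 1) - w.c k
  finite := by
    obtain ⟨n, hn⟩ := w.isCarry.finite
    refine ⟨max n w.x.bound, fun k hk => ?_⟩
    rw [hn (k + 1) (by omega), w.x.val_eq_zero (by omega)]
    omega
  le_one h k := by
    rw [w.isCarry.step k]
    exact (w.isCarry.admissible k).exchange.left h

/-- The second row after the exchange. -/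
def outY (w : Config ε δ) : Row δ where
  val k := w.y.val k + w.c (k + 1) - w.c k
  finite := by
    obtain ⟨n, hn⟩ := w.isCarry.finite
    refine ⟨max n w.y.bound, fun k hk => ?_⟩
    rw [hn (k + 1) (by omega), w.y.val_eq_zero (by omega)]
    omega
  le_one h k := by
    rw [w.isCarry.step k]
    exact (w.isCarry.admissible k).exchange.right h

/-- The number of pairs that leave at the bottom. -/
def out (w : Config ε δ) : Mult ε δ := ⟨w.c 0, fun h => w.isCarry.pair_le_one h 0⟩

theorem le_x (w : Config ε δ) (k : ℕ) : w.c k ≤ w.x.val k + w.c (k + 1) := by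
  rw [w.isCarry.step k]
  exact carry_le_left (w.isCarry.admissible k)

theorem le_y (w : Config ε δ) (k : ℕ) : w.c k ≤ w.y.val k + w.c (k + 1) := by
  rw [w.isCarry.step k]
  exact carry_le_right (w.isCarry.admissible k)

theorem outX_add (w : Config ε δ) (k : ℕ) :
    w.outX.val k + w.c k = w.x.val k + w.c (k + 1) :=
  Nat.sub_add_cancel (w.le_x k)

theorem outY_add (w : Config ε δ) (k : ℕ) :
    w.outY.val k + w.c k = w.y.val k + w.c (k + 1) :=
  Nat.sub_add_cancel (w.le_y k)

/-- The involution read upwards: the outgoing rows and the carry below recover the carry above. -/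
theorem c_succ (w : Config ε δ) (k : ℕ) :
    w.c (k + 1) = carry ε δ (w.outX.val k) (w.outY.val k) (w.c k) := by
  have h := carry_carry (w.isCarry.admissible k)
  rw [← w.isCarry.step k] at h
  exact h.symm

/-- The outgoing data determine the carries from the bottom up, and these determine the incoming
rows by conservation at each level; `upCarry` supplies the preimage. -/
theorem bijective_out :
    Function.Bijective fun w : Config ε δ => (w.outY, w.outX, w.out) := by
  constructor
  · intro v w e
    obtain ⟨hy, e⟩ := Prod.mk.inj e
    obtain ⟨hx, hz⟩ := Prod.mk.inj e
    have hc : v.c = w.c := by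
      funext k
      induction k with
      | zero => exact congrArg Subtype.val hz
      | succ k ih => rw [v.c_succ, w.c_succ, hx, hy, ih]
    refine Config.ext (Row.ext (funext fun k => ?_)) (Row.ext (funext fun k => ?_)) hc
    · have h₁ := v.outX_add k
      have h₂ := w.outX_add k
      rw [hx, hc] at h₁
      omega
    · have h₁ := v.outY_add k
      have h₂ := w.outY_add k
      rw [hy, hc] at h₁
      omega
  · rintro ⟨y, x, z⟩
    set c := upCarry ε δ x.val y.val z with hc
    have hs : ∀ k, c (k + 1) = carry ε δ (x.val k) (y.val k) (c k) := fun k => rfl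
    have hA : ∀ k, Admissible ε δ (x.val k) (y.val k) (c k) := fun k =>
      ⟨fun h => x.le_one h k, fun h => y.le_one h k, fun h => upCarry_pair_le_one x y z h k⟩
    have hfin : ∃ n, ∀ k, n ≤ k → c k = 0 := upCarry_finite x y z
    obtain ⟨n, hn⟩ := hfin
    have hx := fun k => carry_le_left (hA k)
    have hy := fun k => carry_le_right (hA k)
    refine ⟨⟨⟨fun k => x.val k + c k - c (k + 1), ⟨max n x.bound, fun k hk => ?_⟩, fun h k => ?_⟩,
      ⟨fun k => y.val k + c k - c (k + 1), ⟨max n y.bound, fun k hk => ?_⟩, fun h k => ?_⟩, c,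
      ⟨⟨n, hn⟩, fun k => (carry_carry (hA k)).symm⟩⟩, ?_⟩
    · rw [hn k (by omega), x.val_eq_zero (by omega)]
      omega
    · exact (hA k).exchange.left h
    · rw [hn k (by omega), y.val_eq_zero (by omega)]
      omega
    · exact (hA k).exchange.right h
    · refine Prod.ext (Row.ext (funext fun k => ?_)) (Prod.ext (Row.ext (funext fun k => ?_)) rfl)
      · have := hy k
        rw [← hs] at this
        change y.val k + c k - c (k + 1) + c (k + 1) - c k = y.val k
        omega
      · have := hx k
        rw [← hs] at this
        change x.val k + c k - c (k + 1) + c (k + 1) - c k = x.val k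
        omega

/-- A level above which nothing happens. -/
theorem exists_bound (w : Config ε δ) : ∃ n, w.c n = 0 ∧ w.x.bound ≤ n ∧ w.y.bound ≤ n ∧
    w.outX.bound ≤ n ∧ w.outY.bound ≤ n := by
  obtain ⟨m, hm⟩ := w.isCarry.finite
  exact ⟨m + w.x.bound + w.y.bound + w.outX.bound + w.outY.bound, hm _ (by omega), by omega,
    by omega, by omega, by omega⟩

theorem total_x (w : Config ε δ) : w.x.total = w.outX.total + w.out := by
  obtain ⟨n, hc, hx, -, hx', -⟩ := w.exists_bound
  -- The level identities `outX_add` telescope.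
  have key : ∀ n, ∑ k ∈ Finset.range n, w.x.val k + w.c n =
      ∑ k ∈ Finset.range n, w.outX.val k + w.c 0 := by
    intro n
    induction n with
    | zero => simp
    | succ n ih =>
      have := w.outX_add n
      rw [Finset.sum_range_succ, Finset.sum_range_succ]
      omega
  have := key n
  rwa [hc, add_zero, w.x.total_eq hx, w.outX.total_eq hx'] at this

theorem total_y (w : Config ε δ) : w.y.total = w.outY.total + w.out := by
  obtain ⟨n, hc, -, hy, -, hy'⟩ := w.exists_bound
  have key : ∀ n, ∑ k ∈ Finset.range n, w.y.val k + w.c n =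
      ∑ k ∈ Finset.range n, w.outY.val k + w.c 0 := by
    intro n
    induction n with
    | zero => simp
    | succ n ih =>
      have := w.outY_add n
      rw [Finset.sum_range_succ, Finset.sum_range_succ]
      omega
  have := key n
  rwa [hc, add_zero, w.y.total_eq hy, w.outY.total_eq hy'] at this

end Config

/-! ### Relations between the generators -/

/-- The generator `u_{k+1}`. -/
noncomputable def ua (k : ℕ) : PlacticAlgebra := u (pos k.succPNat)

/-- The generator `u_{(k+1)^∨}`. -/
noncomputable def ub (k : ℕ) : PlacticAlgebra := u (dual k.succPNat)

theorem ua_zero_mul_ub_zero : ua 0 * ub 0 = algebraMap ℚ[T;T⁻¹] PlacticAlgebra t := by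
  have h := RingQuot.mkAlgHom_rel ℚ[T;T⁻¹] PlacticRel.cancel
  rw [map_mul, AlgHom.commutes] at h
  exact h

theorem ua_succ_mul_ub_succ (k : ℕ) : ua (k + 1) * ub (k + 1) = ub k * ua k := by
  have h := RingQuot.mkAlgHom_rel ℚ[T;T⁻¹] (PlacticRel.cross k.succPNat)
  rw [map_mul, map_mul] at h
  exact h

theorem commute_ua_ub {i j : ℕ} (h : i ≠ j) : Commute (ua i) (ub j) := by
  have h := RingQuot.mkAlgHom_rel ℚ[T;T⁻¹]
    (PlacticRel.comm i.succPNat j.succPNat (fun e => h (Nat.succPNat_injective e)))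
  rw [map_mul, map_mul] at h
  exact h

theorem ua_pow_mul_ub_pow_zero (c : ℕ) :
    ua 0 ^ c * ub 0 ^ c = algebraMap ℚ[T;T⁻¹] PlacticAlgebra (t ^ c) := by
  induction c with
  | zero => simp
  | succ c ih =>
    rw [pow_succ, pow_succ', mul_assoc, ← mul_assoc (ua 0) (ub 0), ua_zero_mul_ub_zero,
      Algebra.left_comm, ih, ← map_mul, pow_succ']

/-- The inner `c` pairs drop first; the result commutes outwards past the outermost letters, which
then meet and drop as well. -/
theorem ua_pow_mul_ub_pow_succ (k c : ℕ) :
    ua (k + 1) ^ c * ub (k + 1) ^ c = ub k ^ c * ua k ^ c := by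
  induction c with
  | zero => simp
  | succ c ih =>
    have h₁ : Commute (ua (k + 1)) (ub k ^ c) := (commute_ua_ub (by omega)).pow_right c
    have h₂ : Commute (ua k ^ c) (ub (k + 1)) := (commute_ua_ub (by omega)).pow_left c
    calc ua (k + 1) ^ (c + 1) * ub (k + 1) ^ (c + 1)
        = ua (k + 1) * (ua (k + 1) ^ c * ub (k + 1) ^ c) * ub (k + 1) := by
          rw [pow_succ', pow_succ]; simp only [mul_assoc]
      _ = (ua (k + 1) * ub k ^ c) * (ua k ^ c * ub (k + 1)) := by rw [ih]; simp only [mul_assoc]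
      _ = ub k ^ c * (ua (k + 1) * ub (k + 1)) * ua k ^ c := by
          rw [h₁.eq, h₂.eq]; simp only [mul_assoc]
      _ = ub k ^ (c + 1) * ua k ^ (c + 1) := by
          rw [ua_succ_mul_ub_succ, pow_succ, pow_succ']; simp only [mul_assoc]

/-! ### Words of rows -/

/-- The product of the first letters of a truncated row. -/
noncomputable def prodA (ε : ZMod 2) (x : ℕ → ℕ) (n : ℕ) : PlacticAlgebra :=
  ((levelWord (ε ≠ 0) x n).map ua).prod

/-- The product of the dual letters of a truncated row. -/
noncomputable def prodB (δ : ZMod 2) (y : ℕ → ℕ) (n : ℕ) : PlacticAlgebra :=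
  ((levelWord (δ = 0) y n).map ub).prod

section Prod

variable (x : ℕ → ℕ) (n : ℕ)

@[simp] theorem prodA_zero (ε : ZMod 2) : prodA ε x 0 = 1 := by simp [prodA, levelWord]

@[simp] theorem prodB_zero (δ : ZMod 2) : prodB δ x 0 = 1 := by simp [prodB, levelWord]

theorem prodA_even_succ : prodA 0 x (n + 1) = ua n ^ x n * prodA 0 x n := by
  simp [prodA, levelWord]

theorem prodA_odd_succ : prodA 1 x (n + 1) = prodA 1 x n * ua n ^ x n := by
  simp [prodA, levelWord]

theorem prodB_even_succ : prodB 0 x (n + 1) = prodB 0 x n * ub n ^ x n := by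
  simp [prodB, levelWord]

theorem prodB_odd_succ : prodB 1 x (n + 1) = ub n ^ x n * prodB 1 x n := by
  simp [prodB, levelWord]

variable {n}

theorem commute_ub_prodA (ε : ZMod 2) {k : ℕ} (hk : n ≤ k) : Commute (prodA ε x n) (ub k) := by
  refine Commute.list_prod_left _ _ fun g hg => ?_
  obtain ⟨i, hi, rfl⟩ := List.mem_map.1 hg
  exact commute_ua_ub (by have := lt_of_mem_levelWord hi; omega)

theorem commute_ua_prodB (δ : ZMod 2) {k : ℕ} (hk : n ≤ k) : Commute (ua k) (prodB δ x n) := by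
  refine Commute.list_prod_right _ _ fun g hg => ?_
  obtain ⟨i, hi, rfl⟩ := List.mem_map.1 hg
  exact commute_ua_ub (by have := lt_of_mem_levelWord hi; omega)

end Prod

/-! ### The exchange of two rows in the plactic algebra -/

namespace Config

/-- Letters descend and dual letters ascend, so the top level stands at the two ends and the pairs
in transit enclose the product. -/
theorem prod_even_even (w : Config 0 0) (n : ℕ) :
    ua n ^ w.c n * (prodA 0 w.x.val n * prodB 0 w.y.val n) * ub n ^ w.c n =
      t ^ w.c 0 • (prodB 0 w.outY.val n * prodA 0 w.outX.val n) := by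
  induction n with
  | zero => simp [ua_pow_mul_ub_pow_zero, Algebra.algebraMap_eq_smul_one]
  | succ n ih =>
    have hm := w.isCarry.step n
    rw [carry_zero_zero] at hm
    have hx := w.outX_add n
    have hy := w.outY_add n
    obtain ⟨d, hd⟩ := Nat.exists_eq_add_of_le' (show w.c n ≤ w.x.val n by omega)
    obtain ⟨e, he⟩ := Nat.exists_eq_add_of_le' (show w.c n ≤ w.y.val n by omega)
    have hx' : w.outX.val n = w.c (n + 1) + d := by omega
    have hy' : w.outY.val n = e + w.c (n + 1) := by omega
    -- `d` and `e` count the unpaired letters; as `w.c n` is the minimum, one of them is zero.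
    have hde : ua n ^ d * ub n ^ e = ub n ^ e * ua n ^ d := by
      rcases (show d = 0 ∨ e = 0 by omega) with rfl | rfl <;> simp
    set c := w.c (n + 1)
    have h₁ : Commute (ua (n + 1) ^ c * ua n ^ d) (prodB 0 w.outY.val n) :=
      ((commute_ua_prodB _ _ (by omega)).pow_left _).mul_left
        ((commute_ua_prodB _ _ le_rfl).pow_left _)
    have h₂ : Commute (prodA 0 w.outX.val n) (ub n ^ e * ub (n + 1) ^ c) :=
      ((commute_ub_prodA _ _ le_rfl).pow_right _).mul_right
        ((commute_ub_prodA _ _ (by omega)).pow_right _)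
    have h₃ : Commute (ua (n + 1) ^ c) (ub n ^ e) := (commute_ua_ub (by omega)).pow_pow _ _
    have h₄ : Commute (ua n ^ d) (ub (n + 1) ^ c) := (commute_ua_ub (by omega)).pow_pow _ _
    calc ua (n + 1) ^ c * (prodA 0 w.x.val (n + 1) * prodB 0 w.y.val (n + 1)) * ub (n + 1) ^ c
        = (ua (n + 1) ^ c * ua n ^ d) * (ua n ^ w.c n * (prodA 0 w.x.val n * prodB 0 w.y.val n) *
            ub n ^ w.c n) * (ub n ^ e * ub (n + 1) ^ c) := by
          rw [prodA_even_succ, prodB_even_succ, hd, he, add_comm e, pow_add, pow_add]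
          simp only [mul_assoc]
      _ = t ^ w.c 0 • (((ua (n + 1) ^ c * ua n ^ d) * prodB 0 w.outY.val n) *
            (prodA 0 w.outX.val n * (ub n ^ e * ub (n + 1) ^ c))) := by
          rw [ih, mul_smul_comm, smul_mul_assoc]
          simp only [mul_assoc]
      _ = t ^ w.c 0 • (prodB 0 w.outY.val n * (ua (n + 1) ^ c * (ua n ^ d * ub n ^ e) *
            ub (n + 1) ^ c) * prodA 0 w.outX.val n) := by
          rw [h₁.eq, h₂.eq]
          simp only [mul_assoc]
      _ = t ^ w.c 0 • (prodB 0 w.outY.val n * ((ua (n + 1) ^ c * ub n ^ e) *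
            (ua n ^ d * ub (n + 1) ^ c)) * prodA 0 w.outX.val n) := by
          rw [hde]
          simp only [mul_assoc]
      _ = t ^ w.c 0 • (prodB 0 w.outY.val n * (ub n ^ e * (ua (n + 1) ^ c * ub (n + 1) ^ c) *
            ua n ^ d) * prodA 0 w.outX.val n) := by
          rw [h₃.eq, h₄.eq]
          simp only [mul_assoc]
      _ = t ^ w.c 0 • (prodB 0 w.outY.val (n + 1) * prodA 0 w.outX.val (n + 1)) := by
          rw [ua_pow_mul_ub_pow_succ, prodA_even_succ, prodB_even_succ, hx', hy', pow_add, pow_add]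
          simp only [mul_assoc]

/-- The exchange at one level for two rows of degree `1`. -/
theorem level_odd_odd {M : Type*} [Monoid M] (a b : M) (w : Config 1 1) (n : ℕ) :
    a ^ w.x.val n * (b * a) ^ w.c (n + 1) * b ^ w.y.val n =
      b ^ w.outY.val n * (a * b) ^ w.c n * a ^ w.outX.val n := by
  have hm := w.isCarry.step n
  rw [carry_one_one] at hm
  have hx := w.outX_add n
  have hy := w.outY_add n
  have hX := w.x.le_one one_ne_zero n
  have hY := w.y.le_one one_ne_zero n
  have key : ∀ c, a * (b * a) ^ c = (a * b) ^ c * a := fun c => by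
    induction c with
    | zero => simp
    | succ c ih => rw [pow_succ', pow_succ', mul_assoc b a, ih]; simp only [mul_assoc]
  have key' : ∀ c, b * (a * b) ^ c = (b * a) ^ c * b := fun c => by
    induction c with
    | zero => simp
    | succ c ih => rw [pow_succ', pow_succ', mul_assoc a b, ih]; simp only [mul_assoc]
  generalize w.c (n + 1) = c at *
  generalize w.c n = c' at *
  generalize w.x.val n = x at *
  generalize w.y.val n = y at *
  generalize w.outX.val n = x' at *
  generalize w.outY.val n = y' at *
  interval_cases x <;> interval_cases y
  · cases c with
    | zero =>
      obtain ⟨rfl, rfl, rfl⟩ : c' = 0 ∧ x' = 0 ∧ y' = 0 := by omega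
      simp
    | succ c =>
      -- An empty level breaks up one incoming pair: `(b a)^(c+1) = b (a b)^c a`.
      obtain ⟨rfl, rfl, rfl⟩ : c' = c ∧ x' = 1 ∧ y' = 1 := by omega
      simp [pow_succ, key', mul_assoc]
  · obtain ⟨rfl, rfl, rfl⟩ : c' = c ∧ x' = 0 ∧ y' = 1 := by omega
    simp [key']
  · obtain ⟨rfl, rfl, rfl⟩ : c' = c ∧ x' = 1 ∧ y' = 0 := by omega
    simp [key]
  · obtain ⟨rfl, rfl, rfl⟩ : c' = c + 1 ∧ x' = 0 ∧ y' = 0 := by omega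
    simp [key, pow_succ, mul_assoc]

/-- Letters ascend and dual letters descend, so the top levels meet in the middle. There the pairs
form an alternating word, which `level_odd_odd` merely regroups. -/
theorem prod_odd_odd (w : Config 1 1) (n : ℕ) :
    prodA 1 w.x.val n * (ua n * ub n) ^ w.c n * prodB 1 w.y.val n =
      t ^ w.c 0 • (prodB 1 w.outY.val n * prodA 1 w.outX.val n) := by
  induction n with
  | zero =>
    rw [ua_zero_mul_ub_zero, ← map_pow]
    simp [Algebra.algebraMap_eq_smul_one]
  | succ n ih =>
    have h₁ : Commute (prodA 1 w.x.val n) (ub n ^ w.outY.val n) :=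
      (commute_ub_prodA _ _ le_rfl).pow_right _
    have h₂ : Commute (ua n ^ w.outX.val n) (prodB 1 w.y.val n) :=
      (commute_ua_prodB _ _ le_rfl).pow_left _
    calc prodA 1 w.x.val (n + 1) * (ua (n + 1) * ub (n + 1)) ^ w.c (n + 1) *
          prodB 1 w.y.val (n + 1)
        = prodA 1 w.x.val n * (ua n ^ w.x.val n * (ub n * ua n) ^ w.c (n + 1) *
            ub n ^ w.y.val n) * prodB 1 w.y.val n := by
          rw [ua_succ_mul_ub_succ, prodA_odd_succ, prodB_odd_succ]
          simp only [mul_assoc]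
      _ = (prodA 1 w.x.val n * ub n ^ w.outY.val n) * (ua n * ub n) ^ w.c n *
            (ua n ^ w.outX.val n * prodB 1 w.y.val n) := by
          rw [level_odd_odd]
          simp only [mul_assoc]
      _ = ub n ^ w.outY.val n * (prodA 1 w.x.val n * (ua n * ub n) ^ w.c n *
            prodB 1 w.y.val n) * ua n ^ w.outX.val n := by
          rw [h₁.eq, h₂.eq]
          simp only [mul_assoc]
      _ = t ^ w.c 0 • (prodB 1 w.outY.val (n + 1) * prodA 1 w.outX.val (n + 1)) := by
          rw [ih, mul_smul_comm, smul_mul_assoc, prodA_odd_succ, prodB_odd_succ]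
          simp only [mul_assoc]

/-- The exchange at one level for rows of degrees `0` and `1`. -/
theorem level_even_odd {M : Type*} [Monoid M] (a b : M) (w : Config 0 1) (n : ℕ) :
    b ^ w.c (n + 1) * a ^ w.c (n + 1) * (a ^ w.x.val n * b ^ w.y.val n) =
      b ^ w.outY.val n * a ^ w.outX.val n * (a ^ w.c n * b ^ w.c n) := by
  have hm := w.isCarry.step n
  rw [carry_zero_one] at hm
  have hx := w.outX_add n
  have hy := w.outY_add n
  have hY := w.y.le_one one_ne_zero n
  have hC := w.isCarry.pair_le_one zero_ne_one (n + 1)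
  rw [mul_assoc, ← mul_assoc (a ^ _) (a ^ _), ← pow_add, mul_assoc (b ^ w.outY.val n),
    ← mul_assoc (a ^ w.outX.val n), ← pow_add, hx, add_comm (w.c (n + 1))]
  -- The minimum is attained either by the dual letters, or by the letters when there are none, and
  -- then nothing moves.
  rcases (show w.outY.val n = w.c (n + 1) ∧ w.c n = w.y.val n ∨
      w.x.val n + w.c (n + 1) = 0 ∧ w.c (n + 1) = 0 ∧ w.c n = 0 ∧ w.outY.val n = w.y.val n
      by omega) with ⟨h₁, h₂⟩ | ⟨h₁, h₂, h₃, h₄⟩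
  · rw [h₁, h₂]
  · rw [h₁, h₂, h₃, h₄]
    simp

/-- Both words descend, so the pairs in transit sit at the left end. -/
theorem prod_even_odd (w : Config 0 1) (n : ℕ) :
    ua n ^ w.c n * ub n ^ w.c n * (prodA 0 w.x.val n * prodB 1 w.y.val n) =
      t ^ w.c 0 • (prodB 1 w.outY.val n * prodA 0 w.outX.val n) := by
  induction n with
  | zero => simp [ua_pow_mul_ub_pow_zero, Algebra.algebraMap_eq_smul_one]
  | succ n ih =>
    have h₁ : Commute (prodA 0 w.x.val n) (ub n ^ w.y.val n) :=
      (commute_ub_prodA _ _ le_rfl).pow_right _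
    have h₂ : Commute (ua n ^ w.outX.val n) (prodB 1 w.outY.val n) :=
      (commute_ua_prodB _ _ le_rfl).pow_left _
    calc ua (n + 1) ^ w.c (n + 1) * ub (n + 1) ^ w.c (n + 1) *
          (prodA 0 w.x.val (n + 1) * prodB 1 w.y.val (n + 1))
        = ub n ^ w.c (n + 1) * ua n ^ w.c (n + 1) * (ua n ^ w.x.val n *
            (prodA 0 w.x.val n * ub n ^ w.y.val n)) * prodB 1 w.y.val n := by
          rw [ua_pow_mul_ub_pow_succ, prodA_even_succ, prodB_odd_succ]
          simp only [mul_assoc]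
      _ = (ub n ^ w.c (n + 1) * ua n ^ w.c (n + 1) * (ua n ^ w.x.val n * ub n ^ w.y.val n)) *
            (prodA 0 w.x.val n * prodB 1 w.y.val n) := by
          rw [h₁.eq]
          simp only [mul_assoc]
      _ = ub n ^ w.outY.val n * ua n ^ w.outX.val n * (ua n ^ w.c n * ub n ^ w.c n *
            (prodA 0 w.x.val n * prodB 1 w.y.val n)) := by
          rw [level_even_odd]
          simp only [mul_assoc]
      _ = t ^ w.c 0 • (ub n ^ w.outY.val n * (ua n ^ w.outX.val n * prodB 1 w.outY.val n) *
            prodA 0 w.outX.val n) := by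
          rw [ih, mul_smul_comm]
          simp only [mul_assoc]
      _ = t ^ w.c 0 • (prodB 1 w.outY.val (n + 1) * prodA 0 w.outX.val (n + 1)) := by
          rw [h₂.eq, prodA_even_succ, prodB_odd_succ]
          simp only [mul_assoc]

/-- The exchange at one level for rows of degrees `1` and `0`. -/
theorem level_odd_even {M : Type*} [Monoid M] (a b : M) (w : Config 1 0) (n : ℕ) :
    a ^ w.x.val n * b ^ w.y.val n * (b ^ w.c (n + 1) * a ^ w.c (n + 1)) =
      a ^ w.c n * b ^ w.c n * (b ^ w.outY.val n * a ^ w.outX.val n) := by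
  have hm := w.isCarry.step n
  rw [carry_one_zero] at hm
  have hx := w.outX_add n
  have hy := w.outY_add n
  have hX := w.x.le_one one_ne_zero n
  have hC := w.isCarry.pair_le_one one_ne_zero (n + 1)
  rw [mul_assoc, ← mul_assoc (b ^ _) (b ^ _), ← pow_add, mul_assoc (a ^ w.c n),
    ← mul_assoc (b ^ w.c n), ← pow_add, add_comm (w.c n), hy]
  rcases (show w.outX.val n = w.c (n + 1) ∧ w.c n = w.x.val n ∨
      w.y.val n + w.c (n + 1) = 0 ∧ w.c (n + 1) = 0 ∧ w.c n = 0 ∧ w.outX.val n = w.x.val n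
      by omega) with ⟨h₁, h₂⟩ | ⟨h₁, h₂, h₃, h₄⟩
  · rw [h₁, h₂]
  · rw [h₁, h₂, h₃, h₄]
    simp

/-- Both words ascend, so the pairs in transit sit at the right end. -/
theorem prod_odd_even (w : Config 1 0) (n : ℕ) :
    prodA 1 w.x.val n * prodB 0 w.y.val n * (ua n ^ w.c n * ub n ^ w.c n) =
      t ^ w.c 0 • (prodB 0 w.outY.val n * prodA 1 w.outX.val n) := by
  induction n with
  | zero => simp [ua_pow_mul_ub_pow_zero, Algebra.algebraMap_eq_smul_one]
  | succ n ih =>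
    have h₁ : Commute (ua n ^ w.x.val n) (prodB 0 w.y.val n) :=
      (commute_ua_prodB _ _ le_rfl).pow_left _
    have h₂ : Commute (prodA 1 w.outX.val n) (ub n ^ w.outY.val n) :=
      (commute_ub_prodA _ _ le_rfl).pow_right _
    calc prodA 1 w.x.val (n + 1) * prodB 0 w.y.val (n + 1) *
          (ua (n + 1) ^ w.c (n + 1) * ub (n + 1) ^ w.c (n + 1))
        = prodA 1 w.x.val n * (ua n ^ w.x.val n * prodB 0 w.y.val n) * (ub n ^ w.y.val n *
            (ub n ^ w.c (n + 1) * ua n ^ w.c (n + 1))) := by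
          rw [ua_pow_mul_ub_pow_succ, prodA_odd_succ, prodB_even_succ]
          simp only [mul_assoc]
      _ = prodA 1 w.x.val n * prodB 0 w.y.val n * (ua n ^ w.x.val n * ub n ^ w.y.val n *
            (ub n ^ w.c (n + 1) * ua n ^ w.c (n + 1))) := by
          rw [h₁.eq]
          simp only [mul_assoc]
      _ = prodA 1 w.x.val n * prodB 0 w.y.val n * (ua n ^ w.c n * ub n ^ w.c n) *
            (ub n ^ w.outY.val n * ua n ^ w.outX.val n) := by
          rw [level_odd_even]
          simp only [mul_assoc]
      _ = t ^ w.c 0 • (prodB 0 w.outY.val n * (prodA 1 w.outX.val n * ub n ^ w.outY.val n) *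
            ua n ^ w.outX.val n) := by
          rw [ih, smul_mul_assoc]
          simp only [mul_assoc]
      _ = t ^ w.c 0 • (prodB 0 w.outY.val (n + 1) * prodA 1 w.outX.val (n + 1)) := by
          rw [h₂.eq, prodA_odd_succ, prodB_even_succ]
          simp only [mul_assoc]

theorem prod_eq {ε δ : ZMod 2} (w : Config ε δ) {n : ℕ} (hn : w.c n = 0) :
    prodA ε w.x.val n * prodB δ w.y.val n =
      t ^ w.c 0 • (prodB δ w.outY.val n * prodA ε w.outX.val n) := by
  rcases zmod2_eq_zero_or_one ε with rfl | rfl <;> rcases zmod2_eq_zero_or_one δ with rfl | rfl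
  · simpa [hn] using w.prod_even_even n
  · simpa [hn] using w.prod_even_odd n
  · simpa [hn] using w.prod_odd_even n
  · simpa [hn] using w.prod_odd_odd n

end Config

/-- The monomial of a row of letters. -/
noncomputable def Row.uA {ε : ZMod 2} (x : Row ε) : PlacticAlgebra :=
  ((x.word (ε ≠ 0)).map ua).prod

/-- The monomial of a row of dual letters. -/
noncomputable def Row.uB {δ : ZMod 2} (y : Row δ) : PlacticAlgebra :=
  ((y.word (δ = 0)).map ub).prod

theorem Config.uA_mul_uB {ε δ : ZMod 2} (w : Config ε δ) :
    w.x.uA * w.y.uB = t ^ (w.out : ℕ) • (w.outY.uB * w.outX.uA) := by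
  obtain ⟨n, hc, hx, hy, hx', hy'⟩ := w.exists_bound
  have h := w.prod_eq hc
  simp only [prodA, prodB] at h
  rwa [w.x.word_eq _ hx, w.y.word_eq _ hy, w.outX.word_eq _ hx', w.outY.word_eq _ hy'] at h

/-! ### Exchange of products -/

/-- The elements of `P` can be moved past those of `Q`, at the cost of elements of `R`: there is a
bijection `P × Q ≃ Q × P × R` compatible with weights and with values in the plactic algebra. -/
def Exchange {P Q R W W' : Type*} [Add W] [Add W'] (p : P → PlacticAlgebra)
    (q : Q → PlacticAlgebra) (wP : P → W) (wQ : Q → W') (rP : R → W) (rQ : R → W')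
    (sz : R → ℕ) : Prop :=
  ∃ e : P × Q ≃ Q × P × R, ∀ x y, wP x = wP (e (x, y)).2.1 + rP (e (x, y)).2.2 ∧
    wQ y = wQ (e (x, y)).1 + rQ (e (x, y)).2.2 ∧
    p x * q y = t ^ sz (e (x, y)).2.2 • (q (e (x, y)).1 * p (e (x, y)).2.1)

theorem Row.exchange (ε δ : ZMod 2) :
    Exchange (Row.uA (ε := ε)) (Row.uB (δ := δ)) Row.total Row.total
      (fun z : Mult ε δ => (z : ℕ)) (fun z => (z : ℕ)) (fun z => (z : ℕ)) := by
  let e₁ := Equiv.ofBijective _ (Config.bijective_rows (ε := ε) (δ := δ))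
  let e₂ := Equiv.ofBijective _ (Config.bijective_out (ε := ε) (δ := δ))
  refine ⟨e₁.symm.trans e₂, fun x y => ?_⟩
  obtain ⟨w, hw⟩ := e₁.surjective (x, y)
  rw [← hw]
  simp only [Equiv.trans_apply, Equiv.symm_apply_apply]
  obtain ⟨rfl, rfl⟩ := Prod.mk.inj hw
  exact ⟨w.total_x, w.total_y, w.uA_mul_uB⟩

/-- The tail is adjacent to the element of `Q` and is passed first; what becomes of that element
then passes the head. -/
theorem Exchange.piLeft {n : ℕ} {P R : Fin n → Type*} {Q W W' : Type*} [Add W]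
    [AddCommMonoid W'] {p : ∀ i, P i → PlacticAlgebra} {q : Q → PlacticAlgebra}
    {wP : ∀ i, P i → W} {wQ : Q → W'} {rP : ∀ i, R i → W} {rQ : ∀ i, R i → W'}
    {sz : ∀ i, R i → ℕ} (h : ∀ i, Exchange (p i) q (wP i) wQ (rP i) (rQ i) (sz i)) :
    Exchange (fun x : ∀ i, P i => (List.ofFn fun i => p i (x i)).prod) q
      (fun x i => wP i (x i)) wQ (fun (z : ∀ i, R i) i => rP i (z i))
      (fun z => ∑ i, rQ i (z i)) (fun z => ∑ i, sz i (z i)) := by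
  induction n with
  | zero =>
    refine ⟨⟨fun v => (v.2, v.1, fun i => i.elim0), fun v => (v.2.1, v.1), fun v => rfl,
      fun v => Prod.ext rfl (Prod.ext rfl (Subsingleton.elim _ _))⟩, fun x y => ?_⟩
    exact ⟨Subsingleton.elim _ _, by simp, by simp⟩
  | succ n ih =>
    obtain ⟨e', he'⟩ := ih (fun i => h i.succ)
    obtain ⟨e, he⟩ := h 0
    refine ⟨⟨fun v =>
        let s := e' (Fin.tail v.1, v.2)
        let r := e (v.1 0, s.1)
        (r.1, Fin.cons r.2.1 s.2.1, Fin.cons r.2.2 s.2.2),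
      fun v =>
        let r := e.symm (v.1, v.2.1 0, v.2.2 0)
        let s := e'.symm (r.2, Fin.tail v.2.1, Fin.tail v.2.2)
        (Fin.cons r.1 s.1, s.2), fun v => by simp, fun v => by simp⟩, fun x y => ?_⟩
    obtain ⟨h₁, h₂, h₃⟩ := he' (Fin.tail x) y
    obtain ⟨k₁, k₂, k₃⟩ := he (x 0) (e' (Fin.tail x, y)).1
    refine ⟨?_, ?_, ?_⟩
    · funext i
      refine Fin.cases ?_ (fun i => ?_) i
      · simpa using k₁
      · simpa [Fin.tail] using congrFun h₁ i
    · simp only [Equiv.coe_fn_mk, Fin.sum_univ_succ, Fin.cons_zero, Fin.cons_succ]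
      rw [h₂, k₂, add_assoc]
    · simp only [Equiv.coe_fn_mk, Fin.sum_univ_succ, Fin.cons_zero, Fin.cons_succ, List.ofFn_succ,
        List.prod_cons]
      simp only [Fin.tail] at h₃ k₃ ⊢
      rw [mul_assoc, h₃, mul_smul_comm, ← mul_assoc, k₃, smul_mul_assoc, smul_smul, ← pow_add,
        mul_assoc, add_comm]

/-- Mirror image of `Exchange.piLeft`: here the head is adjacent and goes first. -/
theorem Exchange.piRight {n : ℕ} {Q R : Fin n → Type*} {P W W' : Type*} [AddCommMonoid W]
    [Add W'] {p : P → PlacticAlgebra} {q : ∀ i, Q i → PlacticAlgebra}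
    {wP : P → W} {wQ : ∀ i, Q i → W'} {rP : ∀ i, R i → W} {rQ : ∀ i, R i → W'}
    {sz : ∀ i, R i → ℕ} (h : ∀ i, Exchange p (q i) wP (wQ i) (rP i) (rQ i) (sz i)) :
    Exchange p (fun y : ∀ i, Q i => (List.ofFn fun i => q i (y i)).prod) wP
      (fun y i => wQ i (y i)) (fun z : ∀ i, R i => ∑ i, rP i (z i))
      (fun z i => rQ i (z i)) (fun z => ∑ i, sz i (z i)) := by
  induction n with
  | zero =>
    refine ⟨⟨fun v => (v.2, v.1, fun i => i.elim0), fun v => (v.2.1, v.1), fun v => rfl,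
      fun v => Prod.ext rfl (Prod.ext rfl (Subsingleton.elim _ _))⟩, fun x y => ?_⟩
    exact ⟨by simp, Subsingleton.elim _ _, by simp⟩
  | succ n ih =>
    obtain ⟨e', he'⟩ := ih (fun i => h i.succ)
    obtain ⟨e, he⟩ := h 0
    refine ⟨⟨fun v =>
        let r := e (v.1, v.2 0)
        let s := e' (r.2.1, Fin.tail v.2)
        (Fin.cons r.1 s.1, s.2.1, Fin.cons r.2.2 s.2.2),
      fun v =>
        let s := e'.symm (Fin.tail v.1, v.2.1, Fin.tail v.2.2)
        let r := e.symm (v.1 0, s.1, v.2.2 0)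
        (r.1, Fin.cons r.2 s.2), fun v => by simp, fun v => by simp⟩, fun x y => ?_⟩
    obtain ⟨k₁, k₂, k₃⟩ := he x (y 0)
    obtain ⟨h₁, h₂, h₃⟩ := he' (e (x, y 0)).2.1 (Fin.tail y)
    refine ⟨?_, ?_, ?_⟩
    · simp only [Equiv.coe_fn_mk, Fin.sum_univ_succ, Fin.cons_zero, Fin.cons_succ]
      rw [k₁, h₁, add_assoc, add_comm (∑ i, _)]
    · funext i
      refine Fin.cases ?_ (fun i => ?_) i
      · simpa using k₂
      · simpa [Fin.tail] using congrFun h₂ i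
    · simp only [Equiv.coe_fn_mk, Fin.sum_univ_succ, Fin.cons_zero, Fin.cons_succ, List.ofFn_succ,
        List.prod_cons]
      simp only [Fin.tail] at h₃ k₃ ⊢
      rw [← mul_assoc, k₃, smul_mul_assoc, mul_assoc, h₃, mul_smul_comm, smul_smul, ← pow_add,
        mul_assoc]

/-! ### Matrices -/

theorem sum_map_toMultiset {α T : Type*} [AddCommMonoid T] (F : α →₀ ℕ) (g : α → T) :
    ((Finsupp.toMultiset F).map g).sum = F.sum fun p m => m • g p := by
  classical
  induction F using Finsupp.induction_linear with
  | zero => simp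
  | add F G hF hG =>
    rw [map_add, Multiset.map_add, Multiset.sum_add, hF, hG,
      Finsupp.sum_add_index' (by simp) (by simp [add_smul])]
  | single a n => simp [Finsupp.toMultiset_single, Multiset.map_nsmul, Multiset.sum_nsmul]

namespace Mat

theorem size_eq {A B : Type*} [Z2Graded A] [Z2Graded B] (M : Mat A B) :
    M.size = M.entries.sum fun _ m => m • 1 := by
  simp [size, Finsupp.sum]

section Weights

variable {A B : Type*} [LinearOrder A] [Z2Graded A] [LinearOrder B] [Z2Graded B]

theorem rowWt_eq (M : Mat A B) :
    M.rowWt = M.entries.sum fun p m => m • Finsupp.single p.1 (1 : ℤ) := by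
  rw [← sum_map_toMultiset, ← M.coe_biword, Multiset.map_coe, Multiset.sum_coe, rowWt, wordWt,
    List.map_map]
  rfl

theorem colWt_eq (M : Mat A B) :
    M.colWt = M.entries.sum fun p m => m • Finsupp.single p.2 (1 : ℤ) := by
  rw [← sum_map_toMultiset, ← M.coe_biword, Multiset.map_coe, Multiset.sum_coe, colWt, wordWt,
    List.map_map]
  rfl

theorem sum_entries {T ι : Type*} [AddCommMonoid T] (M : Mat A B) (I : Finset ι) (ψ : ι → A × B)
    (hψ : Function.Injective ψ) (h : ∀ p, M.entries p ≠ 0 → ∃ i ∈ I, ψ i = p) (F : A × B → T) :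
    (M.entries.sum fun p m => m • F p) = ∑ i ∈ I, M.entries (ψ i) • F (ψ i) := by
  classical
  rw [← Finset.sum_image (s := I) (g := ψ) (f := fun p => M.entries p • F p) (hψ.injOn)]
  refine Finsupp.sum_of_support_subset _ (fun p hp => ?_) _ (by simp)
  obtain ⟨i, hi, rfl⟩ := h p (Finsupp.mem_support_iff.1 hp)
  exact Finset.mem_image_of_mem ψ hi

/-- Contributions to a weight are nonnegative and cannot cancel; hence weights control supports. -/
theorem entries_le_rowWt (M : Mat A B) (p : A × B) : (M.entries p : ℤ) ≤ M.rowWt p.1 := by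
  rw [rowWt_eq, Finsupp.sum_apply, Finsupp.sum]
  by_cases hp : p ∈ M.entries.support
  · refine le_trans (le_of_eq ?_) (Finset.single_le_sum (f := fun q =>
      (M.entries q • Finsupp.single q.1 (1 : ℤ)) p.1) (fun q _ => ?_) hp)
    · simp
    · simp only [Finsupp.smul_apply, nsmul_eq_mul, Finsupp.single_apply]
      positivity
  · rw [Finsupp.notMem_support_iff.1 hp]
    refine Finset.sum_nonneg fun q _ => ?_
    simp only [Finsupp.smul_apply, nsmul_eq_mul, Finsupp.single_apply]
    positivity

theorem entries_le_colWt (M : Mat A B) (p : A × B) : (M.entries p : ℤ) ≤ M.colWt p.2 := by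
  rw [colWt_eq, Finsupp.sum_apply, Finsupp.sum]
  by_cases hp : p ∈ M.entries.support
  · refine le_trans (le_of_eq ?_) (Finset.single_le_sum (f := fun q =>
      (M.entries q • Finsupp.single q.2 (1 : ℤ)) p.2) (fun q _ => ?_) hp)
    · simp
    · simp only [Finsupp.smul_apply, nsmul_eq_mul, Finsupp.single_apply]
      positivity
  · rw [Finsupp.notMem_support_iff.1 hp]
    refine Finset.sum_nonneg fun q _ => ?_
    simp only [Finsupp.smul_apply, nsmul_eq_mul, Finsupp.single_apply]
    positivity

end Weights

/-! ### Matrices supported on finitely many rows -/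

section Rows

variable {A C : Type*} [Z2Graded A] [Z2Graded C]

/-- The matrices all of whose nonzero rows are indexed by `s`. -/
abbrev RowsIn (C : Type*) [Z2Graded C] {m : ℕ} (s : Fin m → A) : Type _ :=
  {M : Mat A C // ∀ p, M.entries p ≠ 0 → p.1 ∈ Set.range s}

/-- A row of a matrix. -/
def row (φ : ℕ ≃ C) (hC : ∀ c : C, deg c = 0) (M : Mat A C) (a : A) : Row (deg a) where
  val k := M.entries (a, φ k)
  finite := by
    have hf : {k | M.entries (a, φ k) ≠ 0}.Finite := by
      refine (M.entries.hasFiniteSupport.preimage (f := fun k => (a, φ k)) ?_)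
      exact fun k _ l _ h => φ.injective (Prod.mk.inj h).2
    obtain ⟨n, hn⟩ := hf.bddAbove
    refine ⟨n + 1, fun k hk => ?_⟩
    by_contra h
    have := hn h
    omega
  le_one h k := M.le_one a (φ k) (by rwa [hC])

theorem bijective_rows (φ : ℕ ≃ C) (hC : ∀ c : C, deg c = 0) {m : ℕ} {s : Fin m → A}
    (hs : Function.Injective s) :
    Function.Bijective fun (M : RowsIn C s) (i : Fin m) => M.1.row φ hC (s i) := by
  constructor
  · rintro ⟨M, hM⟩ ⟨M', hM'⟩ h
    refine Subtype.ext (Mat.ext (Finsupp.ext fun p => ?_))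
    by_cases hp : p.1 ∈ Set.range s
    · obtain ⟨a, c⟩ := p
      obtain ⟨i, rfl⟩ := hp
      have := congrFun (congrArg Row.val (congrFun h i)) (φ.symm c)
      simpa [row] using this
    · rw [not_not.1 (mt (hM p) hp), not_not.1 (mt (hM' p) hp)]
  · intro x
    let F : A × C → ℕ := fun p => Function.extend s (fun i => (x i).val) 0 p.1 (φ.symm p.2)
    have hF : ∀ i k, F (s i, k) = (x i).val (φ.symm k) := fun i k => by
      simp only [F]
      rw [hs.extend_apply]
    have hF' : ∀ p, F p ≠ 0 → p.1 ∈ Set.range s := fun p hp => by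
      by_contra h
      exact hp (by simp only [F]; rw [Function.extend_apply' _ _ _ (fun ⟨i, hi⟩ => h ⟨i, hi⟩)]; rfl)
    have hfin : (Function.support F).Finite := by
      refine ((Set.finite_univ (α := Σ i, Fin (x i).bound)).image
        (fun q => (s q.1, φ q.2))).subset fun p hp => ?_
      obtain ⟨a, c⟩ := p
      obtain ⟨i, rfl⟩ := hF' _ hp
      have hk : φ.symm c < (x i).bound := by
        by_contra h
        exact hp (by rw [hF]; exact (x i).val_eq_zero (not_lt.1 h))
      exact ⟨⟨i, ⟨_, hk⟩⟩, trivial, by simp⟩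
    refine ⟨⟨⟨Finsupp.ofSupportFinite F hfin, fun a c h => ?_⟩, hF'⟩, ?_⟩
    · rw [hC] at h
      by_cases ha : a ∈ Set.range s
      · obtain ⟨i, rfl⟩ := ha
        rw [Finsupp.ofSupportFinite_coe, hF]
        exact (x i).le_one h _
      · exact (not_not.1 (mt (hF' (a, c)) ha)).trans_le zero_le_one
    · funext i
      refine Row.ext (funext fun k => ?_)
      change F (s i, φ k) = _
      rw [hF, φ.symm_apply_apply]

theorem exists_level {m : ℕ} {ε : Fin m → ZMod 2} (x : ∀ i, Row (ε i)) :
    ∃ N, ∀ i, (x i).bound ≤ N :=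
  ⟨Finset.univ.sup fun i => (x i).bound,
    fun i => Finset.le_sup (f := fun i => (x i).bound) (Finset.mem_univ i)⟩

variable [LinearOrder A] [LinearOrder C]

theorem sum_rows {T : Type*} [AddCommMonoid T] (φ : ℕ ≃ C) (hC : ∀ c : C, deg c = 0) {m : ℕ}
    {s : Fin m → A} (hs : Function.Injective s) (M : RowsIn C s) {N : ℕ}
    (hN : ∀ i, (M.1.row φ hC (s i)).bound ≤ N) (F : A × C → T) :
    (M.1.entries.sum fun p m => m • F p) =
      ∑ i, ∑ k ∈ Finset.range N, (M.1.row φ hC (s i)).val k • F (s i, φ k) := by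
  rw [M.1.sum_entries (Finset.univ ×ˢ Finset.range N) (fun q : Fin m × ℕ => (s q.1, φ q.2)),
    Finset.sum_product]
  · rfl
  · rintro ⟨i, k⟩ ⟨j, l⟩ h
    obtain ⟨h₁, h₂⟩ := Prod.mk.inj h
    exact Prod.ext (hs h₁) (φ.injective h₂)
  · rintro ⟨a, c⟩ hp
    obtain ⟨i, rfl⟩ := M.2 _ hp
    refine ⟨(i, φ.symm c), ?_, by simp⟩
    simp only [Finset.mem_product, Finset.mem_univ, Finset.mem_range, true_and]
    by_contra h
    refine hp ?_
    have := (M.1.row φ hC (s i)).val_eq_zero ((hN i).trans (not_lt.1 h))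
    simpa [row] using this

theorem rowWt_eq_total (φ : ℕ ≃ C) (hC : ∀ c : C, deg c = 0) {m : ℕ} {s : Fin m → A}
    (hs : Function.Injective s) (M : RowsIn C s) :
    M.1.rowWt = ∑ i, Finsupp.single (s i) ((M.1.row φ hC (s i)).total : ℤ) := by
  obtain ⟨N, hN⟩ := exists_level fun i => M.1.row φ hC (s i)
  rw [rowWt_eq, sum_rows φ hC hs M hN]
  refine Finset.sum_congr rfl fun i _ => ?_
  dsimp only
  rw [← Finset.sum_smul, Row.total_eq _ (hN i)]
  simp

/-- Both sides are sorted for `BLE` and have the same multiset of biletters. The hypotheses `h₀` and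
`h₁` say that `asc` fits the order within a row; it is opposite for letters and dual letters, as `φ`
reverses order for the latter. -/
theorem biword_eq (φ : ℕ ≃ C) (hC : ∀ c : C, deg c = 0) (asc : ZMod 2 → Prop)
    (h₀ : ∀ (a : A) (x : Row (deg a)), deg a = 0 →
      (x.word (asc (deg a))).Pairwise fun k l => φ l ≤ φ k)
    (h₁ : ∀ (a : A) (x : Row (deg a)), deg a = 1 →
      (x.word (asc (deg a))).Pairwise fun k l => φ k ≤ φ l)
    {m : ℕ} (s : Fin m ↪o A) (M : RowsIn C s) :
    M.1.biword = (List.ofFn fun i =>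
      ((M.1.row φ hC (s i)).word (asc (deg (s i)))).map fun k => (s i, φ k)).flatten := by
  classical
  refine List.Perm.eq_of_pairwise' (r := BLE) (Multiset.pairwise_sort _ _) ?_ ?_
  · rw [List.pairwise_flatten]
    refine ⟨fun l hl => ?_, ?_⟩
    · obtain ⟨i, rfl⟩ := List.mem_ofFn.1 hl
      rw [List.pairwise_map]
      rcases zmod2_eq_zero_or_one (deg (s i)) with h | h
      · refine (h₀ _ _ h).imp fun {k l} hkl => ?_
        rcases hkl.eq_or_lt with e | e
        · exact Or.inl (by rw [e])
        · exact Or.inr (Or.inr (Or.inl ⟨rfl, h, e⟩))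
      · refine (h₁ _ _ h).imp fun {k l} hkl => ?_
        rcases hkl.eq_or_lt with e | e
        · exact Or.inl (by rw [e])
        · exact Or.inr (Or.inr (Or.inr ⟨rfl, h, e⟩))
    · rw [List.pairwise_ofFn]
      intro i j hij p hp q hq
      obtain ⟨k, -, rfl⟩ := List.mem_map.1 hp
      obtain ⟨l, -, rfl⟩ := List.mem_map.1 hq
      exact Or.inr (Or.inl (s.strictMono hij))
  · rw [← Multiset.coe_eq_coe, M.1.coe_biword, Finsupp.toMultiset_apply]
    obtain ⟨N, hN⟩ := exists_level fun i => M.1.row φ hC (s i)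
    rw [sum_rows φ hC s.injective M hN]
    have hcoe : ∀ L : List (List (A × C)), (L.flatten : Multiset (A × C)) =
        (L.map Multiset.ofList).sum := fun L => by
      induction L with
      | nil => rfl
      | cons l L ih => rw [List.flatten_cons, ← Multiset.coe_add, ih, List.map_cons, List.sum_cons]
    rw [hcoe, List.map_ofFn, List.sum_ofFn]
    refine Finset.sum_congr rfl fun i _ => ?_
    simp only [Function.comp_apply]
    rw [← Multiset.map_coe, ← Row.word_eq _ _ (hN i), coe_levelWord, ← Multiset.coe_mapAddMonoidHom,
      map_sum]
    simp [Multiset.map_nsmul]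

end Rows

/-! ### Monomials of matrices as products over rows -/

section Monomials

variable {A : Type*} [LinearOrder A] [Z2Graded A]

/-- The column labels `1, 2, …`. -/
def labels : ℕ ≃ ℕ+ := Equiv.pnatEquivNat.symm

/-- The column labels `1^∨, 2^∨, …`. -/
def dualLabels : ℕ ≃ ℕ+ᵒᵈ := labels.trans OrderDual.toDual

theorem labels_mono : Monotone labels := fun _ _ h => Nat.succPNat_le_succPNat.2 h

theorem deg_label (c : ℕ+) : deg c = 0 := rfl

theorem deg_dualLabel (c : ℕ+ᵒᵈ) : deg c = 0 := rfl

theorem uMat_eq {m : ℕ} (s : Fin m ↪o A) (X : RowsIn ℕ+ s) :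
    uMat X.1 = (List.ofFn fun i => (X.1.row labels deg_label (s i)).uA).prod := by
  rw [uMat, uWord, biword_eq labels deg_label (fun ε => ε ≠ 0) _ _ s X, List.map_flatten,
    List.map_flatten, List.prod_flatten, List.map_map, List.map_map, List.map_ofFn]
  · simp only [Function.comp_def, List.map_map]
    rfl
  · exact fun a x h => (pairwise_levelWord_of_not (not_not.2 h) _ _).imp fun h => labels_mono h
  · refine fun a x h => (pairwise_levelWord_of ?_ _ _).imp fun h => labels_mono h
    rw [h]
    exact one_ne_zero

theorem uMatDual_eq {m : ℕ} (s : Fin m ↪o A) (Y : RowsIn ℕ+ᵒᵈ s) :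
    uMatDual Y.1 = (List.ofFn fun i => (Y.1.row dualLabels deg_dualLabel (s i)).uB).prod := by
  rw [uMatDual, uWord, biword_eq dualLabels deg_dualLabel (fun ε => ε = 0) _ _ s Y,
    List.map_flatten, List.map_flatten, List.prod_flatten, List.map_map, List.map_map,
    List.map_ofFn]
  · simp only [Function.comp_def, List.map_map]
    rfl
  · exact fun a x h => (pairwise_levelWord_of h _ _).imp fun h => labels_mono h
  · refine fun a x h => (pairwise_levelWord_of_not ?_ _ _).imp fun h => labels_mono h
    rw [h]
    exact one_ne_zero

end Monomials

/-! ### Matrices with finitely many rows and columns -/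

section Blocks

variable {A B : Type*} [Z2Graded A] [Z2Graded B]

/-- The matrices all of whose nonzero entries are in the rows `s` and the columns `r`. -/
abbrev BlockIn {m n : ℕ} (s : Fin m → A) (r : Fin n → B) : Type _ :=
  {M : Mat A B // ∀ p, M.entries p ≠ 0 → p.1 ∈ Set.range s ∧ p.2 ∈ Set.range r}

/-- The array of entries of a matrix in given rows and columns. -/
def block {m n : ℕ} (s : Fin m → A) (r : Fin n → B) (M : Mat A B) (j : Fin n) (i : Fin m) :
    Mult (deg (s i)) (deg (r j)) :=
  ⟨M.entries (s i, r j), M.le_one _ _⟩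

theorem bijective_block {m n : ℕ} {s : Fin m → A} {r : Fin n → B} (hs : Function.Injective s)
    (hr : Function.Injective r) :
    Function.Bijective fun M : BlockIn s r => block s r M.1 := by
  have hinj : Function.Injective fun q : Fin m × Fin n => (s q.1, r q.2) := by
    rintro ⟨i, j⟩ ⟨i', j'⟩ h
    obtain ⟨h₁, h₂⟩ := Prod.mk.inj h
    exact Prod.ext (hs h₁) (hr h₂)
  constructor
  · rintro ⟨M, hM⟩ ⟨M', hM'⟩ h
    refine Subtype.ext (Mat.ext (Finsupp.ext fun p => ?_))
    by_cases hp : p.1 ∈ Set.range s ∧ p.2 ∈ Set.range r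
    · obtain ⟨a, b⟩ := p
      obtain ⟨⟨i, rfl⟩, ⟨j, rfl⟩⟩ := hp
      exact congrArg Subtype.val (congrFun (congrFun h j) i)
    · rw [not_not.1 (mt (hM p) hp), not_not.1 (mt (hM' p) hp)]
  · intro z
    let F : A × B → ℕ := Function.extend (fun q : Fin m × Fin n => (s q.1, r q.2))
      (fun q => (z q.2 q.1 : ℕ)) 0
    have hF : ∀ i j, F (s i, r j) = z j i := fun i j => hinj.extend_apply _ _ (i, j)
    have hF' : ∀ p, F p ≠ 0 → p.1 ∈ Set.range s ∧ p.2 ∈ Set.range r := fun p hp => by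
      by_contra h
      refine hp (Function.extend_apply' _ _ _ ?_)
      rintro ⟨q, rfl⟩
      exact h ⟨⟨_, rfl⟩, ⟨_, rfl⟩⟩
    have hfin : (Function.support F).Finite := by
      refine ((Set.finite_range s).prod (Set.finite_range r)).subset fun p hp => hF' p hp
    refine ⟨⟨⟨Finsupp.ofSupportFinite F hfin, fun a b h => ?_⟩, hF'⟩, ?_⟩
    · by_cases hp : a ∈ Set.range s ∧ b ∈ Set.range r
      · obtain ⟨⟨i, rfl⟩, ⟨j, rfl⟩⟩ := hp
        rw [Finsupp.ofSupportFinite_coe, hF]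
        exact (z j i).2 h
      · exact (not_not.1 (mt (hF' (a, b)) hp)).trans_le zero_le_one
    · funext j i
      exact Subtype.ext (hF i j)

variable [LinearOrder A] [LinearOrder B]

theorem sum_block {T : Type*} [AddCommMonoid T] {m n : ℕ} {s : Fin m → A} {r : Fin n → B}
    (hs : Function.Injective s) (hr : Function.Injective r) (M : BlockIn s r) (F : A × B → T) :
    (M.1.entries.sum fun p m => m • F p) =
      ∑ j, ∑ i, (block s r M.1 j i : ℕ) • F (s i, r j) := by
  rw [M.1.sum_entries (Finset.univ ×ˢ Finset.univ) (fun q : Fin n × Fin m => (s q.2, r q.1)),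
    Finset.sum_product]
  · rfl
  · rintro ⟨j, i⟩ ⟨j', i'⟩ h
    obtain ⟨h₁, h₂⟩ := Prod.mk.inj h
    exact Prod.ext (hr h₂) (hs h₁)
  · rintro ⟨a, c⟩ hp
    obtain ⟨⟨i, rfl⟩, ⟨j, rfl⟩⟩ := M.2 _ hp
    exact ⟨(j, i), by simp, rfl⟩

end Blocks

/-! ### The exchange of two matrices -/

variable {A B : Type*} [LinearOrder A] [Z2Graded A] [LinearOrder B] [Z2Graded B]

/-- Every row of `X` passes every row of `Y`, and the pairs escaping when row `s i` passes row `r j`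
form the entry of `Z` at `(s i, r j)`. -/
theorem exchange {m n : ℕ} (s : Fin m ↪o A) (r : Fin n ↪o B) :
    Exchange (fun X : RowsIn ℕ+ s => uMat X.1) (fun Y : RowsIn ℕ+ᵒᵈ r => uMatDual Y.1)
      (fun X => X.1.rowWt) (fun Y => Y.1.rowWt) (fun Z : BlockIn s r => Z.1.rowWt)
      (fun Z => Z.1.colWt) (fun Z => Z.1.size) := by
  obtain ⟨e, he⟩ := Exchange.piRight fun j =>
    Exchange.piLeft fun i => Row.exchange (deg (s i)) (deg (r j))
  let eX := Equiv.ofBijective _ (bijective_rows labels deg_label s.injective)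
  let eY := Equiv.ofBijective _ (bijective_rows dualLabels deg_dualLabel r.injective)
  let eZ := Equiv.ofBijective _ (bijective_block s.injective r.injective)
  refine ⟨((eX.prodCongr eY).trans e).trans (eY.prodCongr (eX.prodCongr eZ)).symm,
    fun X Y => ?_⟩
  generalize hw : (((eX.prodCongr eY).trans e).trans (eY.prodCongr (eX.prodCongr eZ)).symm)
    (X, Y) = w
  obtain ⟨Y', X', Z⟩ := w
  have hw' : e (eX X, eY Y) = (eY Y', eX X', eZ Z) := by
    rw [Equiv.trans_apply, Equiv.symm_apply_eq] at hw
    exact hw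
  obtain ⟨h₁, h₂, h₃⟩ := he (eX X) (eY Y)
  rw [hw'] at h₁ h₂ h₃
  refine ⟨?_, ?_, ?_⟩
  · simp only
    rw [rowWt_eq_total labels deg_label s.injective, rowWt_eq_total labels deg_label s.injective,
      rowWt_eq, sum_block s.injective r.injective, Finset.sum_comm, ← Finset.sum_add_distrib]
    refine Finset.sum_congr rfl fun i _ => ?_
    have h := congrFun h₁ i
    simp only [Pi.add_apply, Finset.sum_apply] at h
    dsimp only
    rw [← Finset.sum_smul, Finsupp.smul_single, nsmul_one, ← Finsupp.single_add, ← Nat.cast_add]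
    exact congrArg (fun k : ℕ => Finsupp.single (s i) (k : ℤ)) h
  · simp only
    rw [rowWt_eq_total dualLabels deg_dualLabel r.injective,
      rowWt_eq_total dualLabels deg_dualLabel r.injective,
      colWt_eq, sum_block s.injective r.injective, ← Finset.sum_add_distrib]
    refine Finset.sum_congr rfl fun j _ => ?_
    have h := congrFun h₂ j
    simp only [Pi.add_apply] at h
    dsimp only
    rw [← Finset.sum_smul, Finsupp.smul_single, nsmul_one, ← Finsupp.single_add, ← Nat.cast_add]
    exact congrArg (fun k : ℕ => Finsupp.single (r j) (k : ℤ)) h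
  · simp only
    rw [uMat_eq, uMat_eq, uMatDual_eq, uMatDual_eq, size_eq, sum_block s.injective r.injective]
    simp only [smul_eq_mul, mul_one]
    exact h₃

/-! ### Supports bounded by weights -/

theorem rowsIn_support {C : Type*} [LinearOrder C] [Z2Graded C] (M : Mat A C) {α : A →₀ ℤ}
    (h : ∀ a, M.rowWt a ≤ α a) (p : A × C) (hp : M.entries p ≠ 0) :
    p.1 ∈ Set.range (α.support.orderEmbOfFin rfl) := by
  rw [Finset.range_orderEmbOfFin, Finset.mem_coe, Finsupp.mem_support_iff]
  have := M.entries_le_rowWt p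
  have := h p.1
  omega

theorem colsIn_support {C : Type*} [LinearOrder C] [Z2Graded C] (M : Mat C A) {α : A →₀ ℤ}
    (h : ∀ a, M.colWt a ≤ α a) (p : C × A) (hp : M.entries p ≠ 0) :
    p.2 ∈ Set.range (α.support.orderEmbOfFin rfl) := by
  rw [Finset.range_orderEmbOfFin, Finset.mem_coe, Finsupp.mem_support_iff]
  have := M.entries_le_colWt p
  have := h p.2
  omega

theorem rowWt_nonneg (M : Mat A B) (a : A) : 0 ≤ M.rowWt a := by
  rw [rowWt_eq, Finsupp.sum_apply, Finsupp.sum]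
  refine Finset.sum_nonneg fun q _ => ?_
  simp only [Finsupp.smul_apply, nsmul_eq_mul, Finsupp.single_apply]
  positivity

theorem colWt_nonneg (M : Mat A B) (b : B) : 0 ≤ M.colWt b := by
  rw [colWt_eq, Finsupp.sum_apply, Finsupp.sum]
  refine Finset.sum_nonneg fun q _ => ?_
  simp only [Finsupp.smul_apply, nsmul_eq_mul, Finsupp.single_apply]
  positivity

end Mat

end PlacticKnuth

/-! ### Gluing the bijections over all weights -/

theorem mainTheorem1 {A B : Type*}
    [LinearOrder A] [PlacticKnuth.Z2Graded A] [LinearOrder B] [PlacticKnuth.Z2Graded B] :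
    ∃ f : PlacticKnuth.Mat A ℕ+ × PlacticKnuth.Mat B ℕ+ᵒᵈ →
        PlacticKnuth.Mat B ℕ+ᵒᵈ × PlacticKnuth.Mat A ℕ+ × PlacticKnuth.Mat A B,
      Function.Bijective f ∧
      ∀ (X : PlacticKnuth.Mat A ℕ+) (Y : PlacticKnuth.Mat B ℕ+ᵒᵈ)
        (Y' : PlacticKnuth.Mat B ℕ+ᵒᵈ) (X' : PlacticKnuth.Mat A ℕ+) (Z : PlacticKnuth.Mat A B),
        f (X, Y) = (Y', X', Z) →
          X.rowWt = X'.rowWt + Z.rowWt ∧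
          Y.rowWt = Y'.rowWt + Z.colWt ∧
          PlacticKnuth.uMat X * PlacticKnuth.uMatDual Y =
            PlacticKnuth.t ^ Z.size •
              (PlacticKnuth.uMatDual Y' * PlacticKnuth.uMat X') := by
  choose e he using fun (α : A →₀ ℤ) (β : B →₀ ℤ) => PlacticKnuth.Mat.exchange
    (α.support.orderEmbOfFin rfl) (β.support.orderEmbOfFin rfl)
  let f : PlacticKnuth.Mat A ℕ+ × PlacticKnuth.Mat B ℕ+ᵒᵈ →
      PlacticKnuth.Mat B ℕ+ᵒᵈ × PlacticKnuth.Mat A ℕ+ × PlacticKnuth.Mat A B := fun v =>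
    let w := e v.1.rowWt v.2.rowWt (⟨v.1, v.1.rowsIn_support fun _ => le_rfl⟩,
      ⟨v.2, v.2.rowsIn_support fun _ => le_rfl⟩)
    (w.1.1, w.2.1.1, w.2.2.1)
  -- Stated for free `α` and `β`, so that inputs of equal weight can be compared under the same
  -- equivalence despite the dependent types.
  have hf : ∀ X Y α β hX hY, X.rowWt = α → Y.rowWt = β →
      f (X, Y) = ((e α β (⟨X, hX⟩, ⟨Y, hY⟩)).1.1, (e α β (⟨X, hX⟩, ⟨Y, hY⟩)).2.1.1,
        (e α β (⟨X, hX⟩, ⟨Y, hY⟩)).2.2.1) := by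
    rintro X Y α β hX hY rfl rfl
    rfl
  have hprop : ∀ v, v.1.rowWt = (f v).2.1.rowWt + (f v).2.2.rowWt ∧
      v.2.rowWt = (f v).1.rowWt + (f v).2.2.colWt ∧
      PlacticKnuth.uMat v.1 * PlacticKnuth.uMatDual v.2 =
        PlacticKnuth.t ^ (f v).2.2.size •
          (PlacticKnuth.uMatDual (f v).1 * PlacticKnuth.uMat (f v).2.1) :=
    fun v => he v.1.rowWt v.2.rowWt ⟨v.1, _⟩ ⟨v.2, _⟩
  refine ⟨f, ⟨?_, ?_⟩, ?_⟩
  · rintro ⟨X, Y⟩ ⟨V, W⟩ h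
    -- The image determines the weights of the input, so both inputs are handled by one injective `e
    -- α β`.
    have hX : X.rowWt = V.rowWt := by rw [(hprop (X, Y)).1, h, ← (hprop (V, W)).1]
    have hY : Y.rowWt = W.rowWt := by rw [(hprop (X, Y)).2.1, h, ← (hprop (V, W)).2.1]
    have h₁ := hf X Y V.rowWt W.rowWt (X.rowsIn_support fun _ => (congrFun (congrArg _ hX) _).le)
      (Y.rowsIn_support fun _ => (congrFun (congrArg _ hY) _).le) hX hY
    have h₂ := hf V W V.rowWt W.rowWt (V.rowsIn_support fun _ => le_rfl)
      (W.rowsIn_support fun _ => le_rfl) rfl rfl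
    have h₃ := h₁.symm.trans (h.trans h₂)
    simp only [Prod.mk.injEq] at h₃
    have h₄ := (e V.rowWt W.rowWt).injective
      (Prod.ext (Subtype.ext h₃.1) (Prod.ext (Subtype.ext h₃.2.1) (Subtype.ext h₃.2.2)))
    simpa using h₄
  · rintro ⟨Y', X', Z⟩
    have hX (a : A) : X'.rowWt a ≤ (X'.rowWt + Z.rowWt) a := by
      simpa using Z.rowWt_nonneg a
    have hZ (a : A) : Z.rowWt a ≤ (X'.rowWt + Z.rowWt) a := by
      simpa using X'.rowWt_nonneg a
    have hY (b : B) : Y'.rowWt b ≤ (Y'.rowWt + Z.colWt) b := by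
      simpa using Z.colWt_nonneg b
    have hZ' (b : B) : Z.colWt b ≤ (Y'.rowWt + Z.colWt) b := by
      simpa using Y'.rowWt_nonneg b
    -- The preimage must have these weights, and nonnegativity places `X'`, `Y'` and `Z` within
    -- their supports. That the preimage does have them is `k₁` and `k₂`, so `f` uses this same
    -- equivalence on it.
    obtain ⟨⟨X, Y⟩, hXY⟩ := (e (X'.rowWt + Z.rowWt) (Y'.rowWt + Z.colWt)).surjective
      (⟨Y', Y'.rowsIn_support hY⟩, ⟨X', X'.rowsIn_support hX⟩,
        ⟨Z, fun p hp => ⟨Z.rowsIn_support hZ p hp, Z.colsIn_support hZ' p hp⟩⟩)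
    obtain ⟨k₁, k₂, -⟩ := he (X'.rowWt + Z.rowWt) (Y'.rowWt + Z.colWt) X Y
    rw [hXY] at k₁ k₂
    refine ⟨(X.1, Y.1), ?_⟩
    rw [hf X.1 Y.1 _ _ X.2 Y.2 k₁ k₂, hXY]
  · intro X Y Y' X' Z h
    have := hprop (X, Y)
    rw [h] at this
    exact this
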